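/- Let $G$ be a finite connected graph, with loops and multiple edges allowed, that is cellularly embedded in the Klein bottle $K$ (every face, i.e. every component of $K\setminus G$, is an open disc). Let $G^*$ be the dual graph, drawn in $K$: it has one vertex in each face of $G$, and for each edge $e$ of $G$ one edge $e^*$, which crosses $e$ exactly once, meets $G$ nowhere else, and joins the faces on the two sides of $e$. Suppose that $G^*$ has a Hamiltonian cycle $C^*$ (a loop counts as a cycle of length $1$, and two parallel edges as a cycle of length $2$) that is surface separating, i.e. such that $K\setminus C^*$ is disconnected. Then $$\gamma_M(G)\ \ge\ \left\lfloor \frac{\beta(G)}{2}\right\rfloor-1,$$ where $\beta(G)=|E(G)|-|V(G)|+1$ is the Betti number of $G$, and the maximum genus $\gamma_M(G)$ is the largest integer $k$ such that $G$ has a cellular embedding in the orientable surface of genus $k$ (the sphere with $k$ handles). -/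

import Mathlib

/-!
Finite multigraphs (loops and multiple edges allowed) are Mathlib's `Graph α β`.

Cellular embeddings of graphs in closed surfaces are described combinatorially, by their *flags*.
A cellular embedding cuts the surface into triangles (the barycentric subdivision of the cell
decomposition): a flag is a triangle whose corners are a vertex `v` of the graph, the midpoint of
an edge `e` at `v` and an interior point (centre) of a face at `e`.  Each triangle is glued to
exactly one other triangle along each of its three sides:

* `swapVertex` : along the side from the edge midpoint to the face centre (half of a dual edge);
* `swapEdge` : along the side from the vertex to the face centre;
* `swapFace` : along the side from the vertex to the edge midpoint (half of an edge).
-/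

namespace Graph

/-- A graph is connected if it has a vertex and any two vertices are joined by a walk. -/
def IsConnected {α β : Type*} (G : Graph α β) : Prop :=
  G.vertexSet.Nonempty ∧
    ∀ x ∈ G.vertexSet, ∀ y ∈ G.vertexSet, Relation.ReflTransGen G.Adj x y

/-- The Betti number `|E| - |V| + 1` of a finite connected graph. -/
noncomputable def bettiNumber {α β : Type*} (G : Graph α β) : ℤ :=
  (G.edgeSet.ncard : ℤ) - (G.vertexSet.ncard : ℤ) + 1

/-- `G.IsHamiltonianCycle x e`: the vertices `x 0, …, x n` and the edges `e 0, …, e n` form a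
Hamiltonian cycle of length `n + 1`, where `e i` joins `x i` to `x (i + 1)` (indices modulo
`n + 1`).  A loop is a cycle of length one, two parallel edges form a cycle of length two. -/
structure IsHamiltonianCycle {α β : Type*} (G : Graph α β) {n : ℕ}
    (x : Fin (n + 1) → α) (e : Fin (n + 1) → β) : Prop where
  vertex_injective : Function.Injective x
  edge_injective : Function.Injective e
  isLink : ∀ i, G.IsLink (e i) (x i) (x (i + 1))
  range_vertex : Set.range x = G.vertexSet

/-- A cellular embedding of a finite connected graph `G` in a closed surface, given by its flags
and the way they are glued.  (If `G` has no edge, it is a single vertex, and the embedding without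
flags stands for the embedding of that vertex in the sphere.) -/
structure CellularEmbedding {α β : Type*} (G : Graph α β) where
  /-- The flags. -/
  Flag : Type
  /-- There are finitely many flags. -/
  finite_flag : Finite Flag
  /-- The vertex of a flag. -/
  vertex : Flag → α
  /-- The edge of a flag. -/
  edge : Flag → β
  /-- The flag with the same edge, the same face, on the same side of the edge, at its other end. -/
  swapVertex : Flag → Flag
  /-- The flag in the same corner of the same face at the same vertex, at the next edge. -/
  swapEdge : Flag → Flag
  /-- The flag at the same end of the same edge, on its other side. -/
  swapFace : Flag → Flag
  swapVertex_swapVertex : ∀ f, swapVertex (swapVertex f) = f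
  swapEdge_swapEdge : ∀ f, swapEdge (swapEdge f) = f
  swapFace_swapFace : ∀ f, swapFace (swapFace f) = f
  swapVertex_ne : ∀ f, swapVertex f ≠ f
  swapEdge_ne : ∀ f, swapEdge f ≠ f
  swapFace_ne : ∀ f, swapFace f ≠ f
  /-- Four different flags, glued in a circle, meet at the midpoint of an edge. -/
  swapVertex_swapFace : ∀ f, swapVertex (swapFace f) = swapFace (swapVertex f)
  swapVertex_ne_swapFace : ∀ f, swapVertex f ≠ swapFace f
  /-- An edge joins the vertices of the flags at its two ends. -/
  isLink : ∀ f, G.IsLink (edge f) (vertex f) (vertex (swapVertex f))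
  /-- Every edge of `G` occurs. -/
  exists_edge_eq : ∀ e ∈ G.edgeSet, ∃ f, edge f = e
  edge_swapVertex : ∀ f, edge (swapVertex f) = edge f
  edge_swapFace : ∀ f, edge (swapFace f) = edge f
  /-- The flags of an edge are the four flags around its midpoint. -/
  eq_of_edge_eq : ∀ f g, edge f = edge g →
    g = f ∨ g = swapVertex f ∨ g = swapFace f ∨ g = swapVertex (swapFace f)
  vertex_swapEdge : ∀ f, vertex (swapEdge f) = vertex f
  vertex_swapFace : ∀ f, vertex (swapFace f) = vertex f
  /-- The flags at a vertex form one single circle around it. -/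
  reach_of_vertex_eq : ∀ f g, vertex f = vertex g →
    Relation.ReflTransGen (fun a b => b = swapEdge a ∨ b = swapFace a) f g

namespace CellularEmbedding

/-- The faces: two flags lie in the same face if one gets from one to the other without crossing
an edge of the graph. -/
def Face {α β : Type*} {G : Graph α β} (M : CellularEmbedding G) : Type :=
  Quot (fun a b : M.Flag => b = M.swapVertex a ∨ b = M.swapEdge a)

/-- The face of a flag. -/
def face {α β : Type*} {G : Graph α β} (M : CellularEmbedding G) (f : M.Flag) : M.Face :=
  Quot.mk _ f

open Classical in
/-- The number of faces (a single vertex without edges, embedded in the sphere, has one face). -/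
noncomputable def numFaces {α β : Type*} {G : Graph α β} (M : CellularEmbedding G) : ℕ :=
  if IsEmpty M.Flag then 1 else Nat.card M.Face

/-- The Euler characteristic `|V| - |E| + |F|` of the surface. -/
noncomputable def eulerChar {α β : Type*} {G : Graph α β} (M : CellularEmbedding G) : ℤ :=
  (G.vertexSet.ncard : ℤ) - (G.edgeSet.ncard : ℤ) + (M.numFaces : ℤ)

/-- The surface is orientable: the triangles can be given orientations such that
any two triangles with a common side are coherently oriented; equivalently, they can be coloured
with two colours such that triangles glued along a side get different colours (the colour says
whether the order vertex, edge, face of the corners is positive or negative). -/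
def IsOrientable {α β : Type*} {G : Graph α β} (M : CellularEmbedding G) : Prop :=
  ∃ c : M.Flag → Bool, ∀ f,
    c (M.swapVertex f) ≠ c f ∧ c (M.swapEdge f) ≠ c f ∧ c (M.swapFace f) ≠ c f

/-- The surface is the orientable surface of genus `h`, the sphere with `h` handles. -/
def IsOrientableOfGenus {α β : Type*} {G : Graph α β} (M : CellularEmbedding G) (h : ℕ) : Prop :=
  M.IsOrientable ∧ M.eulerChar = 2 - 2 * (h : ℤ)

/-- The surface is the nonorientable surface of genus `k`, the sphere with `k` crosscaps. -/
def IsNonorientableOfGenus {α β : Type*} {G : Graph α β} (M : CellularEmbedding G) (k : ℕ) :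
    Prop :=
  ¬ M.IsOrientable ∧ M.eulerChar = 2 - (k : ℤ)

/-- The surface is the Klein bottle, the nonorientable surface of genus two. -/
def IsKleinBottle {α β : Type*} {G : Graph α β} (M : CellularEmbedding G) : Prop :=
  M.IsNonorientableOfGenus 2

theorem face_swapVertex {α β : Type*} {G : Graph α β} (M : CellularEmbedding G) (f : M.Flag) :
    M.face (M.swapVertex f) = M.face f :=
  (Quot.sound (r := fun a b : M.Flag => b = M.swapVertex a ∨ b = M.swapEdge a) (Or.inl rfl)).symm

/-- The dual graph: its vertices are the faces, and each edge `e` of `G` gives an edge (with the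
same label `e`) that joins the faces on the two sides of `e`. -/
def dual {α β : Type*} {G : Graph α β} (M : CellularEmbedding G) : Graph M.Face β where
  vertexSet := Set.univ
  edgeSet := G.edgeSet
  IsLink e x y := ∃ f, M.edge f = e ∧ M.face f = x ∧ M.face (M.swapFace f) = y
  isLink_symm := by
    intro e _
    refine ⟨?_⟩
    rintro x y ⟨f, h1, h2, h3⟩
    exact ⟨M.swapFace f, by rw [M.edge_swapFace, h1], h3, by rw [M.swapFace_swapFace, h2]⟩
  eq_or_eq_of_isLink_of_isLink := by
    rintro e x y v w ⟨f, h1, h2, h3⟩ ⟨g, k1, k2, k3⟩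
    subst h2 k2 k3
    rcases M.eq_of_edge_eq f g (h1.trans k1.symm) with h | h | h | h
    · exact Or.inl (by rw [h])
    · exact Or.inl (by rw [h, face_swapVertex])
    · exact Or.inr (by rw [h, M.swapFace_swapFace])
    · exact Or.inr (by rw [h, ← M.swapVertex_swapFace, M.swapFace_swapFace, face_swapVertex])
  edge_mem_iff_exists_isLink := by
    intro e
    constructor
    · intro he
      obtain ⟨f, hf⟩ := M.exists_edge_eq e he
      exact ⟨_, _, f, hf, rfl, rfl⟩
    · rintro ⟨x, y, f, hf, -, -⟩
      exact hf ▸ (M.isLink f).edge_mem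
  left_mem_of_isLink := by
    intro e x y _
    exact Set.mem_univ _

/-- Two flags are glued along a side that is not part of one of the dual edges `e*`, `e ∈ C`. -/
def GluedOff {α β : Type*} {G : Graph α β} (M : CellularEmbedding G) (C : Set β)
    (a b : M.Flag) : Prop :=
  b = M.swapEdge a ∨ b = M.swapFace a ∨ (M.edge a ∉ C ∧ b = M.swapVertex a)

/-- For the edge set `C` of a cycle of the dual graph: that cycle, drawn as the closed curve made
up of the dual edges `e*`, `e ∈ C`, is surface separating, that is, the surface minus the curve is
disconnected.  The dual edge `e*` runs from face centre to face centre through the midpoint of `e`;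
so some two triangles cannot be joined by a chain of triangles in which consecutive triangles are
glued along a side outside the curve. -/
def IsSurfaceSeparating {α β : Type*} {G : Graph α β} (M : CellularEmbedding G) (C : Set β) :
    Prop :=
  ∃ f g : M.Flag, ¬ Relation.ReflTransGen (M.GluedOff C) f g

end CellularEmbedding

/-- The genera of the orientable cellular embeddings of a graph are bounded, so that the supremum
in the definition of the maximum genus below is a maximum. -/
theorem bddAbove_genus {α β : Type*} (G : Graph α β) :
    BddAbove {k : ℕ | ∃ M : CellularEmbedding G, M.IsOrientableOfGenus k} := by
  refine ⟨G.edgeSet.ncard + 1, ?_⟩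
  rintro k ⟨M, -, h⟩
  simp only [CellularEmbedding.eulerChar] at h
  omega

/-- The maximum genus of a finite connected graph: the largest `k` such that the graph has a
cellular embedding in the orientable surface of genus `k`. -/
noncomputable def maxGenus {α β : Type*} (G : Graph α β) : ℕ :=
  sSup {k : ℕ | ∃ M : CellularEmbedding G, M.IsOrientableOfGenus k}

end Graph

/-! The curve `C*` has exactly two sides. The vertices of `G` therefore split into sets `A` and `B`,
each spanned by a tree avoiding the edges of the curve (`exists_isTreeFrom`), and each edge of the
curve joins `A` to `B` (`swapVertex_iff_not`, `reach_iff_not_reach`). As `C*` is Hamiltonian it has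
|F| edges, so |V| - |E| + |F| = 0 leaves exactly |E| - (|V| - 2 + |F|) = 2 further edges.

The core is `IsTreeFrom.hasRotation_union`: two disjoint trees with cross edges between them have an
orientable rotation system with at most two faces. Its engine is `HasRotation.insert_insert`: two
edges with a common end can be added without increasing the number of faces. So a leaf of the first
tree with an even number of cross edges can be removed; a leaf with an odd number can be moved to
the other tree, its old tree edge becoming a cross edge. Once only the root is left, at most one
edge stays unpaired and costs one extra face.

The two further edges cost at most one face each. Thus `G` has an orientable embedding with at most
four faces, and Euler's formula gives 2γ ≥ β - 3. Faces are orbits of a permutation of the darts;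
inserting an edge multiplies this permutation by transpositions, each of which merges two orbits or
splits one. -/

namespace Equiv.Perm

/-! ### Orbits of a permutation multiplied by a transposition -/

variable {D : Type*}

theorem SameCycle.iff_of_forall_apply {τ : Equiv.Perm D} {p : D → Prop}
    (hp : ∀ z, p (τ z) ↔ p z) {x y : D} (h : τ.SameCycle x y) : p x ↔ p y := by
  obtain ⟨i, rfl⟩ := h
  induction i using Int.induction_on with
  | zero => simp
  | succ i ih => rw [ih, add_comm, zpow_add, zpow_one, mul_apply, hp]
  | pred i ih => rw [ih, ← hp ((τ ^ (-(i : ℤ) - 1)) x), ← mul_apply, ← zpow_one_add]; congr! 3; ring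

theorem SameCycle.of_forall_apply {τ τ' : Equiv.Perm D}
    (h : ∀ z, τ'.SameCycle z (τ z)) {x y : D} (hxy : τ.SameCycle x y) : τ'.SameCycle x y :=
  (hxy.iff_of_forall_apply (p := fun z => τ'.SameCycle x z)
    (fun z => ⟨fun hz => hz.trans (h z).symm, fun hz => hz.trans (h z)⟩)).1 (SameCycle.refl _ _)

/-- The number of orbits of a permutation, fixed points included. -/
noncomputable def numOrbits (τ : Equiv.Perm D) : ℕ := Nat.card (Quotient (SameCycle.setoid τ))

theorem numOrbits_one [Finite D] : numOrbits (1 : Equiv.Perm D) = Nat.card D := by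
  symm
  refine Nat.card_congr (Equiv.ofBijective (fun d => Quotient.mk (SameCycle.setoid 1) d) ⟨?_, ?_⟩)
  · intro x y h
    exact sameCycle_one.1 (Quotient.exact h)
  · intro q
    induction q using Quotient.inductionOn with
    | h d => exact ⟨d, rfl⟩

theorem numOrbits_inv (τ : Equiv.Perm D) : numOrbits τ⁻¹ = numOrbits τ := by
  unfold numOrbits
  congr 2
  ext x y
  exact sameCycle_inv

variable [DecidableEq D]

/-- Inversion preserves orbits, so this carries every result on left multiplication by a
transposition over to right multiplication. -/
theorem mul_swap_eq_inv (τ : Equiv.Perm D) (a b : D) : τ * swap a b = (swap a b * τ⁻¹)⁻¹ := by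
  rw [mul_inv_rev, inv_inv, swap_inv]

section Merge

variable [Finite D] {τ : Equiv.Perm D} {a b : D}

/-- Along the `τ`-orbit of `a`, which misses `b`, the product agrees with `τ` until the step that
returns to `a`; that step is redirected to `b`. -/
theorem sameCycle_swap_mul_self (h : ¬ τ.SameCycle a b) : (swap a b * τ).SameCycle a b := by
  set τ' := swap a b * τ with hτ'
  have key : ∀ j : ℕ, τ'.SameCycle a b ∨ τ'.SameCycle a ((τ ^ j) a) := by
    intro j
    induction j with
    | zero => exact Or.inr (SameCycle.refl _ _)
    | succ j ih =>
      rcases ih with ih | ih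
      · exact Or.inl ih
      · have h1 : τ'.SameCycle a (swap a b ((τ ^ (j + 1)) a)) := by
          have : swap a b ((τ ^ (j + 1)) a) = τ' ((τ ^ j) a) := by
            rw [pow_succ', hτ']; rfl
          rw [this]
          exact sameCycle_apply_right.2 ih
        by_cases h2 : (τ ^ (j + 1)) a = a
        · rw [h2, swap_apply_left] at h1
          exact Or.inl h1
        · have h3 : (τ ^ (j + 1)) a ≠ b := by
            intro h3
            exact h ⟨((j + 1 : ℕ) : ℤ), by rw [zpow_natCast]; exact h3⟩
          rw [swap_apply_of_ne_of_ne h2 h3] at h1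
          exact Or.inr h1
  have hN := orderOf_pos τ
  obtain ⟨N, hN'⟩ : ∃ N, orderOf τ = N + 1 := ⟨orderOf τ - 1, by omega⟩
  rcases key N with h1 | h1
  · exact h1
  · rw [← sameCycle_apply_right] at h1
    have : τ' ((τ ^ N) a) = swap a b ((τ ^ (N + 1)) a) := by rw [pow_succ', hτ']; rfl
    rw [this, ← hN', pow_orderOf_eq_one, one_apply, swap_apply_left] at h1
    exact h1

theorem sameCycle_swap_mul_iff (h : ¬ τ.SameCycle a b) {x y : D} :
    (swap a b * τ).SameCycle x y ↔ τ.SameCycle x y ∨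
      (τ.SameCycle a x ∨ τ.SameCycle b x) ∧ (τ.SameCycle a y ∨ τ.SameCycle b y) := by
  have hab := sameCycle_swap_mul_self h
  have hw : ∀ w, (swap a b * τ).SameCycle (swap a b w) w := by
    intro w
    by_cases h1 : w = a
    · rw [h1, swap_apply_left]; exact hab.symm
    by_cases h2 : w = b
    · rw [h2, swap_apply_right]; exact hab
    rw [swap_apply_of_ne_of_ne h1 h2]
  have hle : ∀ {x y}, τ.SameCycle x y → (swap a b * τ).SameCycle x y := by
    intro x y
    refine SameCycle.of_forall_apply fun z => ?_
    refine SameCycle.trans ?_ (hw (τ z))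
    exact sameCycle_apply_right.2 (SameCycle.refl _ _)
  constructor
  · intro hxy
    -- The right-hand side, as a predicate of its last argument, is invariant under `swap a b` and
    -- under `τ`, hence under the product.
    have hs : ∀ z, (τ.SameCycle x (swap a b z) ∨ (τ.SameCycle a x ∨ τ.SameCycle b x) ∧
        (τ.SameCycle a (swap a b z) ∨ τ.SameCycle b (swap a b z))) ↔
        (τ.SameCycle x z ∨
          (τ.SameCycle a x ∨ τ.SameCycle b x) ∧ (τ.SameCycle a z ∨ τ.SameCycle b z)) := by
      intro z
      have ha := SameCycle.refl τ a
      have hb := SameCycle.refl τ b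
      by_cases h1 : z = a
      · rw [h1, swap_apply_left]
        have := sameCycle_comm (f := τ) (x := a) (y := x)
        have := sameCycle_comm (f := τ) (x := b) (y := x)
        tauto
      by_cases h2 : z = b
      · rw [h2, swap_apply_right]
        have := sameCycle_comm (f := τ) (x := a) (y := x)
        have := sameCycle_comm (f := τ) (x := b) (y := x)
        tauto
      rw [swap_apply_of_ne_of_ne h1 h2]
    refine (hxy.iff_of_forall_apply (p := fun z => τ.SameCycle x z ∨
      (τ.SameCycle a x ∨ τ.SameCycle b x) ∧ (τ.SameCycle a z ∨ τ.SameCycle b z))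
      (fun z => ?_)).1 (Or.inl (SameCycle.refl _ _))
    rw [mul_apply, hs, sameCycle_apply_right, sameCycle_apply_right, sameCycle_apply_right]
  · rintro (hxy | ⟨hx | hx, hy | hy⟩)
    · exact hle hxy
    · exact (hle hx).symm.trans (hle hy)
    · exact (hle hx).symm.trans (hab.trans (hle hy))
    · exact (hle hx).symm.trans (hab.symm.trans (hle hy))
    · exact (hle hx).symm.trans (hle hy)

theorem numOrbits_swap_mul_of_not_sameCycle (h : ¬ τ.SameCycle a b) :
    numOrbits (swap a b * τ) + 1 = numOrbits τ := by
  let c : Quotient (SameCycle.setoid τ) := Quotient.mk _ b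
  -- Dropping the orbit of `b` picks one representative of the merged pair, so the other orbits of
  -- `τ` correspond to the orbits of the product.
  let F : {q : Quotient (SameCycle.setoid τ) // q ≠ c} →
      Quotient (SameCycle.setoid (swap a b * τ)) := fun q =>
    Quotient.lift (fun d => Quotient.mk (SameCycle.setoid (swap a b * τ)) d)
      (fun x y hxy => Quotient.sound ((sameCycle_swap_mul_iff h).2 (Or.inl hxy))) q.1
  have hF : Function.Bijective F := by
    constructor
    · rintro ⟨q, hq⟩ ⟨r, hr⟩
      induction q using Quotient.inductionOn with
      | h x =>
        induction r using Quotient.inductionOn with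
        | h y =>
          intro hxy
          have hxy' : (swap a b * τ).SameCycle x y := Quotient.exact hxy
          have hx : ¬ τ.SameCycle b x := fun hx => hq (Quotient.sound hx.symm)
          have hy : ¬ τ.SameCycle b y := fun hy => hr (Quotient.sound hy.symm)
          rw [sameCycle_swap_mul_iff h] at hxy'
          apply Subtype.ext
          apply Quotient.sound
          change τ.SameCycle x y
          rcases hxy' with h1 | ⟨h1 | h1, h2 | h2⟩
          · exact h1
          · exact h1.symm.trans h2
          · exact absurd h2 hy
          · exact absurd h1 hx
          · exact absurd h1 hx
    · intro q
      induction q using Quotient.inductionOn with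
      | h y =>
        by_cases hy : τ.SameCycle b y
        · refine ⟨⟨Quotient.mk _ a, fun h1 => h (Quotient.exact h1)⟩, Quotient.sound ?_⟩
          exact (sameCycle_swap_mul_iff h).2 (Or.inr ⟨Or.inl (SameCycle.refl _ _), Or.inr hy⟩)
        · exact ⟨⟨Quotient.mk _ y, fun h1 => hy (SameCycle.symm (Quotient.exact h1))⟩, rfl⟩
  have h1 : numOrbits (swap a b * τ) = Nat.card {q : Quotient (SameCycle.setoid τ) // q ≠ c} :=
    (Nat.card_congr (Equiv.ofBijective F hF)).symm
  rw [h1]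
  have := Set.ncard_add_ncard_compl ({c} : Set (Quotient (SameCycle.setoid τ)))
  rw [Set.ncard_singleton] at this
  rw [numOrbits, ← this, add_comm]
  rfl

/-- Let `k` be the first time `τ` takes `a` to `b`. The product sends `τ ^ (k - 1) a` back to `a`,
so its orbit through `a` stays among the first `k` iterates, none of which is `b`. -/
theorem not_sameCycle_swap_mul (hab : a ≠ b) (h : τ.SameCycle a b) :
    ¬ (swap a b * τ).SameCycle a b := by
  classical
  have hex : ∃ k : ℕ, (τ ^ k) a = b := h.exists_nat_pow_eq
  set k := Nat.find hex with hk
  have hkb : (τ ^ k) a = b := Nat.find_spec hex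
  have hmin : ∀ j < k, (τ ^ j) a ≠ b := fun j hj => Nat.find_min hex hj
  have hk0 : 0 < k := by
    rcases Nat.eq_zero_or_pos k with h0 | h0
    · rw [h0] at hkb; exact absurd hkb hab
    · exact h0
  have hinv : ∀ n : ℕ, ∃ i < k, ((swap a b * τ) ^ n) a = (τ ^ i) a := by
    intro n
    induction n with
    | zero => exact ⟨0, hk0, rfl⟩
    | succ n ih =>
      obtain ⟨i, hi, hn⟩ := ih
      have hstep : ((swap a b * τ) ^ (n + 1)) a = swap a b ((τ ^ (i + 1)) a) := by
        rw [pow_succ', mul_apply, hn, pow_succ' τ]; rfl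
      rw [hstep]
      by_cases hik : i + 1 = k
      · exact ⟨0, hk0, by rw [hik, hkb, swap_apply_right]; rfl⟩
      · have hne : (τ ^ (i + 1)) a ≠ a := by
          intro hc
          apply hmin (k - (i + 1)) (by omega)
          have : (τ ^ k) a = (τ ^ (k - (i + 1))) ((τ ^ (i + 1)) a) := by
            rw [← mul_apply, ← pow_add]; congr 2; omega
          rw [hc] at this
          rw [← this, hkb]
        exact ⟨i + 1, by omega, swap_apply_of_ne_of_ne hne (hmin _ (by omega))⟩
  intro hc
  obtain ⟨n, hn⟩ := hc.exists_nat_pow_eq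
  obtain ⟨i, hi, h1⟩ := hinv n
  exact hmin i hi (h1 ▸ hn)

theorem numOrbits_swap_mul_of_sameCycle (hab : a ≠ b) (h : τ.SameCycle a b) :
    numOrbits (swap a b * τ) = numOrbits τ + 1 := by
  have := numOrbits_swap_mul_of_not_sameCycle (not_sameCycle_swap_mul hab h)
  rw [← mul_assoc, swap_mul_self, one_mul] at this
  exact this.symm

theorem sameCycle_mul_swap_iff (h : ¬ τ.SameCycle a b) {x y : D} :
    (τ * swap a b).SameCycle x y ↔ τ.SameCycle x y ∨
      (τ.SameCycle a x ∨ τ.SameCycle b x) ∧ (τ.SameCycle a y ∨ τ.SameCycle b y) := by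
  rw [mul_swap_eq_inv, sameCycle_inv, sameCycle_swap_mul_iff (by rwa [sameCycle_inv])]
  simp only [sameCycle_inv]

theorem numOrbits_mul_swap_of_not_sameCycle (h : ¬ τ.SameCycle a b) :
    numOrbits (τ * swap a b) + 1 = numOrbits τ := by
  rw [mul_swap_eq_inv, numOrbits_inv, ← numOrbits_inv τ]
  exact numOrbits_swap_mul_of_not_sameCycle (by rwa [sameCycle_inv])

theorem not_sameCycle_mul_swap (hab : a ≠ b) (h : τ.SameCycle a b) :
    ¬ (τ * swap a b).SameCycle a b := by
  rw [mul_swap_eq_inv, sameCycle_inv]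
  exact not_sameCycle_swap_mul hab (by rwa [sameCycle_inv])

theorem numOrbits_mul_swap_of_sameCycle (hab : a ≠ b) (h : τ.SameCycle a b) :
    numOrbits (τ * swap a b) = numOrbits τ + 1 := by
  rw [mul_swap_eq_inv, numOrbits_inv, ← numOrbits_inv τ]
  exact numOrbits_swap_mul_of_sameCycle hab (by rwa [sameCycle_inv])

end Merge

/-- Each transposition changes both the sign and the parity of the number of orbits. -/
theorem sign_eq_neg_one_pow_numOrbits [Fintype D] (τ : Equiv.Perm D) :
    sign τ = (-1) ^ (Nat.card D + numOrbits τ) := by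
  induction τ using swap_induction_on with
  | one => rw [numOrbits_one, ← two_mul]; simp
  | swap_mul f x y hxy ih =>
    rw [sign_mul, sign_swap hxy, ih]
    by_cases h : f.SameCycle x y
    · rw [numOrbits_swap_mul_of_sameCycle hxy h, ← add_assoc, pow_succ']
    · rw [← numOrbits_swap_mul_of_not_sameCycle h, ← add_assoc, pow_succ', ← mul_assoc]
      simp

end Equiv.Perm

/-! ### Rotation systems on subsets of the edges, and trees -/

namespace RotationSystem

open Equiv Equiv.Perm

variable {E V : Type*}

/-- `e` joins `x` and `y`, where `v (e, b)` are the ends of `e`. -/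
def Links (v : E × Bool → V) (e : E) (x y : V) : Prop := ∃ b, v (e, b) = x ∧ v (e, !b) = y

theorem Links.symm {v : E × Bool → V} {e : E} {x y : V} (h : Links v e x y) : Links v e y x := by
  obtain ⟨b, h1, h2⟩ := h
  exact ⟨!b, h2, by rwa [Bool.not_not]⟩

/-- The darts of the edges in `S`. -/
def darts (S : Finset E) : Set (E × Bool) := {d | d.1 ∈ S}

theorem mem_darts {S : Finset E} {d : E × Bool} : d ∈ darts S ↔ d.1 ∈ S := Iff.rfl

/-- `σ` is supported on the darts in `X` and permutes the darts of `X` at each vertex cyclically. -/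
structure IsRotation {D : Type*} (v : D → V) (X : Set D) (σ : Perm D) : Prop where
  apply_of_notMem : ∀ d ∉ X, σ d = d
  sameCycle_iff : ∀ d ∈ X, ∀ d' ∈ X, σ.SameCycle d d' ↔ v d = v d'

section Insert

variable {D : Type*} {v : D → V} {X : Set D} {σ : Perm D} {c d : D}

theorem sameCycle_iff_eq_of_apply_eq (h : σ d = d) {z : D} : σ.SameCycle d z ↔ d = z :=
  ⟨fun hz => hz.eq_of_left h, fun hz => hz ▸ SameCycle.refl _ _⟩

theorem IsRotation.insert_of_ne (h : IsRotation v X σ) (hd : d ∉ X) (hv : ∀ c ∈ X, v c ≠ v d) :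
    IsRotation v (insert d X) σ := by
  have hσ := h.apply_of_notMem d hd
  refine ⟨fun z hz => h.apply_of_notMem z fun hz' => hz (Or.inr hz'), ?_⟩
  rintro x (rfl | hx) y (rfl | hy)
  · simp [SameCycle.refl]
  · rw [sameCycle_iff_eq_of_apply_eq hσ]
    exact ⟨fun he => by rw [he], fun he => absurd he.symm (hv y hy)⟩
  · rw [sameCycle_comm, sameCycle_iff_eq_of_apply_eq hσ]
    exact ⟨fun he => by rw [he], fun he => absurd he (hv x hx)⟩
  · exact h.sameCycle_iff x hx y hy

/-- `σ * swap c d` sends `c` to `d` and `d` to `σ c`: the new dart enters the cyclic order right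
after `c`, that is, in the corner of `c`. -/
theorem IsRotation.insert_of_eq [DecidableEq D] [Finite D] (h : IsRotation v X σ) (hd : d ∉ X)
    (hc : c ∈ X) (hv : v c = v d) : IsRotation v (insert d X) (σ * swap c d) := by
  have hσ := h.apply_of_notMem d hd
  have hcd : c ≠ d := fun hcd => hd (hcd ▸ hc)
  have hnot : ¬ σ.SameCycle c d := fun hs => hcd (hs.eq_of_right hσ)
  constructor
  · intro z hz
    have h1 : z ≠ c := fun h1 => hz (Or.inr (h1 ▸ hc))
    have h2 : z ≠ d := fun h2 => hz (Or.inl h2)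
    rw [mul_apply, swap_apply_of_ne_of_ne h1 h2]
    exact h.apply_of_notMem z fun hz' => hz (Or.inr hz')
  · have hne : ∀ x ∈ X, ¬ d = x := fun x hx he => hd (he ▸ hx)
    rintro x (rfl | hx) y (rfl | hy)
    · simp [SameCycle.refl]
    · rw [sameCycle_mul_swap_iff hnot, sameCycle_iff_eq_of_apply_eq hσ,
        sameCycle_iff_eq_of_apply_eq hσ, h.sameCycle_iff c hc y hy, hv]
      have := hne y hy
      tauto
    · rw [sameCycle_mul_swap_iff hnot, sameCycle_comm (x := x), sameCycle_iff_eq_of_apply_eq hσ,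
        sameCycle_iff_eq_of_apply_eq hσ, h.sameCycle_iff c hc x hx, hv,
        eq_comm (a := v x)]
      have := hne x hx
      tauto
    · rw [sameCycle_mul_swap_iff hnot, sameCycle_iff_eq_of_apply_eq hσ,
        sameCycle_iff_eq_of_apply_eq hσ, h.sameCycle_iff c hc x hx, h.sameCycle_iff c hc y hy,
        h.sameCycle_iff x hx y hy]
      have := hne x hx
      have := hne y hy
      constructor
      · rintro (h1 | ⟨h1 | h1, h2 | h2⟩)
        · exact h1
        · exact h1.symm.trans h2
        · contradiction
        · contradiction
        · contradiction
      · exact Or.inl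

end Insert

variable [DecidableEq E]

/-- The involution that exchanges the two darts of every edge in `S`. -/
def flip (S : Finset E) : Perm (E × Bool) :=
  Function.Involutive.toPerm (fun d => if d.1 ∈ S then (d.1, !d.2) else d) (by
    rintro ⟨e, b⟩
    by_cases h : e ∈ S <;> simp [h])

theorem flip_of_mem {S : Finset E} {d : E × Bool} (h : d.1 ∈ S) : flip S d = (d.1, !d.2) :=
  if_pos h

theorem flip_of_notMem {S : Finset E} {d : E × Bool} (h : d.1 ∉ S) : flip S d = d :=
  if_neg h

theorem flip_insert {S : Finset E} {e : E} (he : e ∉ S) (b : Bool) :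
    flip (insert e S) = flip S * swap (e, b) (e, !b) := by
  ext1 ⟨e', b'⟩
  rw [mul_apply]
  by_cases h : e' = e
  · subst h
    rw [flip_of_mem (d := (e', b')) (Finset.mem_insert_self _ _)]
    have : swap (e', b) (e', !b) (e', b') = (e', !b') := by
      cases b <;> cases b' <;> simp
    rw [this, flip_of_notMem (d := (e', !b')) he]
  · rw [swap_apply_of_ne_of_ne (by simp [h]) (by simp [h])]
    by_cases h' : e' ∈ S
    · rw [flip_of_mem (S := S) (d := (e', b')) h', flip_of_mem (by simp [h'])]
    · rw [flip_of_notMem (S := S) (d := (e', b')) h', flip_of_notMem (by simp [h, h'])]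

theorem darts_insert (S : Finset E) (e : E) (b : Bool) :
    darts (insert e S) = insert (e, !b) (insert (e, b) (darts S)) := by
  ext ⟨e', b'⟩
  simp only [mem_darts, Finset.mem_insert, Set.mem_insert_iff, Prod.mk.injEq]
  cases b <;> cases b' <;> simp

variable {v : E × Bool → V} {S : Finset E} {σ : Perm (E × Bool)} {U : Set V}

/-- The face permutation. -/
def facePerm (S : Finset E) (σ : Perm (E × Bool)) : Perm (E × Bool) := σ⁻¹ * flip S

theorem facePerm_apply_of_notMem (h : IsRotation v (darts S) σ) {d : E × Bool} (hd : d.1 ∉ S) :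
    facePerm S σ d = d := by
  rw [facePerm, mul_apply, flip_of_notMem hd, inv_eq_iff_eq]
  exact (h.apply_of_notMem d hd).symm

theorem image_darts_insert {e : E} {x y : V} (he : Links v e x y) :
    v '' darts (insert e S) = insert y (insert x (v '' darts S)) := by
  obtain ⟨b, rfl, rfl⟩ := he
  rw [darts_insert S e b, Set.image_insert_eq, Set.image_insert_eq]

/-- The edge set `S` is a tree with vertex set `U`, grown from the vertex `r`. -/
inductive IsTreeFrom (v : E × Bool → V) (r : V) : Set V → Finset E → Prop
  | single : IsTreeFrom v r {r} ∅
  | grow {U : Set V} {S : Finset E} {e : E} {x y : V} : IsTreeFrom v r U S → x ∈ U → y ∉ U →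
      Links v e x y → IsTreeFrom v r (insert y U) (insert e S)

namespace IsTreeFrom

variable {r : V}

theorem root_mem (h : IsTreeFrom v r U S) : r ∈ U := by
  induction h with
  | single => rfl
  | grow _ _ _ _ ih => exact Or.inr ih

theorem image_subset (h : IsTreeFrom v r U S) : v '' darts S ⊆ U := by
  induction h with
  | single => rintro _ ⟨d, hd, rfl⟩; simp [mem_darts] at hd
  | grow _ hx _ he ih =>
    rw [image_darts_insert he]
    refine Set.insert_subset_insert (Set.insert_subset hx ih)

theorem notMem (h : IsTreeFrom v r U S) {e : E} {x y : V} (he : Links v e x y) (hy : y ∉ U) :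
    e ∉ S := by
  intro heS
  obtain ⟨b, rfl, rfl⟩ := he
  exact hy (h.image_subset ⟨_, heS, rfl⟩)

theorem finite (h : IsTreeFrom v r U S) : U.Finite := by
  induction h with
  | single => exact Set.finite_singleton _
  | grow _ _ _ _ ih => exact ih.insert _

theorem ncard_eq (h : IsTreeFrom v r U S) : U.ncard = S.card + 1 := by
  induction h with
  | single => simp
  | grow h hx hy he ih =>
    rw [Set.ncard_insert_of_notMem hy h.finite, ih,
      Finset.card_insert_of_notMem (h.notMem he hy)]

end IsTreeFrom

/-! ### Change of the number of faces when one or two edges are inserted -/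

variable [Finite E]

/-- Darts outside `S` are fixed by the face permutation and count as orbits. Losing two orbits means
that the two new darts are absorbed and the number of genuine faces is unchanged. -/
theorem exists_insert_pendant (h : IsRotation v (darts S) σ) {e : E} (he : e ∉ S) (b : Bool)
    {c : E × Bool} (hc : c ∈ darts S) (hv : v c = v (e, b)) (hne : v (e, b) ≠ v (e, !b))
    (hfresh : ∀ z ∈ darts S, v z ≠ v (e, !b)) :
    ∃ σ', IsRotation v (darts (insert e S)) σ' ∧
      numOrbits (facePerm (insert e S) σ') + 2 = numOrbits (facePerm S σ) := by
  set φ := facePerm S σ with hφ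
  have hd : φ (e, b) = (e, b) := facePerm_apply_of_notMem h he
  have hd' : φ (e, !b) = (e, !b) := facePerm_apply_of_notMem h he
  have hcd : c ≠ (e, b) := by rintro rfl; exact he hc
  have hcd' : c ≠ (e, !b) := by rintro rfl; exact he hc
  have hdd' : (e, b) ≠ (e, !b) := by simp
  refine ⟨σ * swap c (e, b), ?_, ?_⟩
  · rw [darts_insert S e b]
    refine (h.insert_of_eq he hc hv).insert_of_ne ?_ ?_
    · rintro (h1 | h1)
      · exact hdd' h1.symm
      · exact he h1
    · rintro z (rfl | hz)
      · exact hne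
      · exact hfresh z hz
  · have hφ' : facePerm (insert e S) (σ * swap c (e, b)) =
        (swap c (e, b) * φ) * swap (e, b) (e, !b) := by
      rw [facePerm, flip_insert he b, mul_inv_rev, swap_inv, hφ, facePerm]
      simp only [mul_assoc]
    have h1 : ¬ φ.SameCycle c (e, b) := fun hs => hcd (hs.eq_of_right hd)
    have h2 : (swap c (e, b) * φ) (e, !b) = (e, !b) := by
      rw [mul_apply, hd', swap_apply_of_ne_of_ne hcd'.symm hdd'.symm]
    have h3 : ¬ (swap c (e, b) * φ).SameCycle (e, b) (e, !b) := fun hs => hdd' (hs.eq_of_right h2)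
    have o1 := numOrbits_swap_mul_of_not_sameCycle h1
    have o2 := numOrbits_mul_swap_of_not_sameCycle h3
    rw [hφ']
    omega

/-- Net of the two absorbed darts, an edge drawn between corners of different faces merges these
faces (a drop of 3), and one drawn inside a face splits it (a drop of 1). In the second case both
new faces have a corner at the end `v (e, b)`, which is what lets a second edge at that vertex merge
them again. -/
theorem exists_insert_edge (h : IsRotation v (darts S) σ) {e : E} (he : e ∉ S) (b : Bool)
    {c c' : E × Bool} (hc : c ∈ darts S) (hc' : c' ∈ darts S) (hv : v c = v (e, b))
    (hv' : v c' = v (e, !b)) :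
    ∃ σ', IsRotation v (darts (insert e S)) σ' ∧
      (¬ (facePerm S σ).SameCycle c c' →
        numOrbits (facePerm (insert e S) σ') + 3 = numOrbits (facePerm S σ)) ∧
      ((facePerm S σ).SameCycle c c' →
        numOrbits (facePerm (insert e S) σ') + 1 = numOrbits (facePerm S σ) ∧
        ∃ x ∈ darts (insert e S), ∃ y ∈ darts (insert e S), v x = v (e, b) ∧ v y = v (e, b) ∧
          ¬ (facePerm (insert e S) σ').SameCycle x y) := by
  set φ := facePerm S σ with hφ
  have hd : φ (e, b) = (e, b) := facePerm_apply_of_notMem h he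
  have hd' : φ (e, !b) = (e, !b) := facePerm_apply_of_notMem h he
  have hcd : c ≠ (e, b) := by rintro rfl; exact he hc
  have hcd' : c ≠ (e, !b) := by rintro rfl; exact he hc
  have hc'd : c' ≠ (e, b) := by rintro rfl; exact he hc'
  have hc'd' : c' ≠ (e, !b) := by rintro rfl; exact he hc'
  have hdd' : (e, b) ≠ (e, !b) := by simp
  have hφ' : facePerm (insert e S) (σ * swap c (e, b) * swap c' (e, !b)) =
      (swap c' (e, !b) * (swap c (e, b) * φ)) * swap (e, b) (e, !b) := by
    rw [facePerm, flip_insert he b, mul_inv_rev, mul_inv_rev, swap_inv, swap_inv, hφ, facePerm]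
    simp only [mul_assoc]
  have h1 : ¬ φ.SameCycle c (e, b) := fun hs => hcd (hs.eq_of_right hd)
  have h2 : (swap c (e, b) * φ) (e, !b) = (e, !b) := by
    rw [mul_apply, hd', swap_apply_of_ne_of_ne hcd'.symm hdd'.symm]
  have h3 : ¬ (swap c (e, b) * φ).SameCycle c' (e, !b) := fun hs => hc'd' (hs.eq_of_right h2)
  have o1 := numOrbits_swap_mul_of_not_sameCycle h1
  have o2 := numOrbits_swap_mul_of_not_sameCycle h3
  set τ := swap c' (e, !b) * (swap c (e, b) * φ) with hτ
  -- The left multiplications put `(e, b)` into the orbit of `c` and `(e, !b)` into that of `c'`;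
  -- the last transposition then merges or splits according to whether these orbits differ.
  have key : τ.SameCycle (e, b) (e, !b) ↔ φ.SameCycle c c' := by
    have k1 : ¬ (swap c (e, b) * φ).SameCycle (e, !b) (e, b) := fun hs =>
      hdd' (hs.eq_of_left h2).symm
    have k2 : ¬ (swap c (e, b) * φ).SameCycle (e, b) (e, !b) := fun hs => k1 hs.symm
    rw [hτ, sameCycle_swap_mul_iff h3]
    have k3 : (swap c (e, b) * φ).SameCycle c' (e, b) ↔ φ.SameCycle c c' := by
      rw [sameCycle_swap_mul_iff h1, sameCycle_comm (x := c') (y := (e, b)),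
        sameCycle_iff_eq_of_apply_eq hd, sameCycle_iff_eq_of_apply_eq hd]
      have := hc'd.symm
      tauto
    rw [k3]
    have := SameCycle.refl (swap c (e, b) * φ) (e, !b)
    tauto
  refine ⟨σ * swap c (e, b) * swap c' (e, !b), ?_, ?_, ?_⟩
  · rw [darts_insert S e b]
    refine (h.insert_of_eq he hc hv).insert_of_eq ?_ (Or.inr hc') hv'
    rintro (h1 | h1)
    · exact hdd' h1.symm
    · exact he h1
  · intro hs
    rw [hφ']
    have o3 := numOrbits_mul_swap_of_not_sameCycle (mt key.1 hs)
    omega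
  · intro hs
    rw [hφ']
    have o3 := numOrbits_mul_swap_of_sameCycle hdd' (key.2 hs)
    have n3 := not_sameCycle_mul_swap hdd' (key.2 hs)
    refine ⟨by omega, (e, b), by simp [mem_darts], ?_⟩
    -- If `c = c'`, the edge is a loop and its own darts are the witnesses; otherwise the face
    -- permutation takes `(e, !b)` to `c`.
    by_cases hcc : c = c'
    · refine ⟨(e, !b), by simp [mem_darts], rfl, ?_, n3⟩
      rw [← hv', ← hcc, hv]
    · refine ⟨c, by simp [mem_darts, mem_darts.1 hc], rfl, hv, fun hs' => n3 (hs'.trans ?_)⟩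
      have : (τ * swap (e, b) (e, !b)) (e, !b) = c := by
        rw [mul_apply, swap_apply_right, hτ, mul_apply, mul_apply, hd, swap_apply_right,
          swap_apply_of_ne_of_ne hcc hcd']
      rw [← this]
      exact sameCycle_apply_left.2 (SameCycle.refl _ _)

/-- The graph formed by the edges in `S`, whose vertices form the set `U`, has a rotation system
with at most `k` faces. -/
def HasRotation (v : E × Bool → V) (S : Finset E) (U : Set V) (k : ℕ) : Prop :=
  ∃ σ, IsRotation v (darts S) σ ∧ v '' darts S = U ∧
    numOrbits (facePerm S σ) + 2 * S.card ≤ k + Nat.card (E × Bool)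

/-- The smallest case: a lone vertex carries no dart and so is never the vertex set in
`HasRotation`. -/
theorem hasRotation_singleton {e : E} {x y : V} (he : Links v e x y) (hxy : x ≠ y) :
    HasRotation v {e} {y, x} 1 := by
  have hU := image_darts_insert (S := ∅) he
  obtain ⟨b, rfl, rfl⟩ := he
  have h0 : darts (∅ : Finset E) = ∅ := by ext; simp [mem_darts]
  have h1 : IsRotation v (darts ∅) (1 : Perm (E × Bool)) := ⟨fun _ _ => rfl, by simp [h0]⟩
  have h2 : (e, b) ≠ (e, !b) := by simp
  refine ⟨1, ?_, ?_, ?_⟩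
  · rw [← insert_empty_eq, darts_insert ∅ e b]
    refine (h1.insert_of_ne (by simp [h0]) (by simp [h0])).insert_of_ne ?_ ?_
    · rintro (h | h)
      · exact h2 h.symm
      · exact absurd h (by simp [h0])
    · rintro z (rfl | h)
      · exact hxy
      · exact absurd h (by simp [h0])
  · rw [← insert_empty_eq, hU, h0, Set.image_empty, insert_empty_eq]
  · have h3 : facePerm {e} 1 = 1 * swap (e, b) (e, !b) := by
      rw [facePerm, ← insert_empty_eq, flip_insert (by simp) b]
      congr 1
    have o := numOrbits_mul_swap_of_not_sameCycle (τ := (1 : Perm (E × Bool)))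
      (a := (e, b)) (b := (e, !b)) (by rw [sameCycle_one]; exact h2)
    rw [numOrbits_one] at o
    rw [h3, Finset.card_singleton]
    omega

theorem HasRotation.insert_pendant {k : ℕ} (h : HasRotation v S U k) {e : E} {x y : V}
    (he : Links v e x y) (hx : x ∈ U) (hy : y ∉ U) :
    HasRotation v (insert e S) (insert y U) k := by
  obtain ⟨σ, hσ, rfl, ho⟩ := h
  have hU := image_darts_insert (S := S) he
  obtain ⟨b, rfl, rfl⟩ := he
  obtain ⟨c, hc, hcv⟩ := hx
  have heS : e ∉ S := fun heS => hy ⟨_, heS, rfl⟩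
  obtain ⟨σ', h1, h2⟩ := exists_insert_pendant hσ heS b hc hcv
    (fun h => hy ⟨c, hc, hcv.trans h⟩) (fun z hz h => hy ⟨z, hz, h⟩)
  refine ⟨σ', h1, ?_, ?_⟩
  · have hx : v (e, b) ∈ v '' darts S := ⟨c, hc, hcv⟩
    rw [hU, Set.insert_eq_of_mem hx]
  · rw [Finset.card_insert_of_notMem heS]
    omega

theorem HasRotation.insert_edge {k : ℕ} (h : HasRotation v S U k) {e : E} (heS : e ∉ S) {x y : V}
    (he : Links v e x y) (hx : x ∈ U) (hy : y ∈ U) :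
    HasRotation v (insert e S) U (k + 1) := by
  obtain ⟨σ, hσ, rfl, ho⟩ := h
  have hU := image_darts_insert (S := S) he
  obtain ⟨b, rfl, rfl⟩ := he
  rw [Set.insert_eq_of_mem hx, Set.insert_eq_of_mem hy] at hU
  obtain ⟨c, hc, hcv⟩ := hx
  obtain ⟨c', hc', hcv'⟩ := hy
  obtain ⟨σ', h1, h2, h3⟩ := exists_insert_edge hσ heS b hc hc' hcv hcv'
  refine ⟨σ', h1, hU, ?_⟩
  rw [Finset.card_insert_of_notMem heS]
  by_cases hs : (facePerm S σ).SameCycle c c'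
  · have := (h3 hs).1
    omega
  · have := h2 hs
    omega

/-- One of the two edges can always be made to merge two faces, which pays for the face the other
may create. The common end `x` is essential. -/
theorem HasRotation.insert_insert {k : ℕ} (h : HasRotation v S U k) {e f : E} (heS : e ∉ S)
    (hfS : f ∉ insert e S) {x y z : V} (he : Links v e x y) (hf : Links v f x z) (hx : x ∈ U)
    (hy : y ∈ U) (hz : z ∈ U) : HasRotation v (insert f (insert e S)) U k := by
  obtain ⟨σ, hσ, rfl, ho⟩ := h
  have hU := image_darts_insert (S := S) he
  have hU' := image_darts_insert (S := insert e S) hf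
  rw [Set.insert_eq_of_mem hx, Set.insert_eq_of_mem hy] at hU
  rw [hU, Set.insert_eq_of_mem hx, Set.insert_eq_of_mem hz] at hU'
  obtain ⟨b, rfl, rfl⟩ := he
  obtain ⟨b', hf1, rfl⟩ := hf
  have hcard : (insert f (insert e S)).card = S.card + 2 := by
    rw [Finset.card_insert_of_notMem hfS, Finset.card_insert_of_notMem heS]
  -- If the ends of `e` have corners in different faces, `e` merges them and `f` may go anywhere.
  by_cases hmerge : ∃ c ∈ darts S, ∃ c' ∈ darts S, v c = v (e, b) ∧ v c' = v (e, !b) ∧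
      ¬ (facePerm S σ).SameCycle c c'
  · obtain ⟨c, hc, c', hc', hcv, hcv', hs⟩ := hmerge
    obtain ⟨σ', h1, h2, -⟩ := exists_insert_edge hσ heS b hc hc' hcv hcv'
    have o1 := h2 hs
    rw [← hU, ← hf1] at hx
    rw [← hU] at hz
    obtain ⟨c, hc, hcv⟩ := hx
    obtain ⟨c', hc', hcv'⟩ := hz
    obtain ⟨σ'', h1', h2', h3'⟩ := exists_insert_edge h1 hfS b' hc hc' hcv hcv'
    refine ⟨σ'', h1', hU', ?_⟩
    by_cases hs' : (facePerm (insert e S) σ').SameCycle c c'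
    · have := (h3' hs').1
      omega
    · have := h2' hs'
      omega
  -- Otherwise `e` splits a face into two, both with a corner at `x`. Any corner at `z` misses one
  -- of them, and `f` merges that one with the face at `z`.
  · push Not at hmerge
    obtain ⟨c, hc, hcv⟩ := hx
    obtain ⟨c', hc', hcv'⟩ := hy
    obtain ⟨σ', h1, -, h3⟩ := exists_insert_edge hσ heS b hc hc' hcv hcv'
    obtain ⟨o1, p, hp, q, hq, hpv, hqv, hpq⟩ := h3 (hmerge c hc c' hc' hcv hcv')
    rw [← hU] at hz
    obtain ⟨r, hr, hrv⟩ := hz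
    obtain ⟨s, hs, hsv, hsr⟩ : ∃ s ∈ darts (insert e S), v s = v (f, b') ∧
        ¬ (facePerm (insert e S) σ').SameCycle s r := by
      by_cases hpr : (facePerm (insert e S) σ').SameCycle p r
      · exact ⟨q, hq, hqv.trans hf1.symm, fun hqr => hpq (hpr.trans hqr.symm)⟩
      · exact ⟨p, hp, hpv.trans hf1.symm, hpr⟩
    obtain ⟨σ'', h1', h2', -⟩ := exists_insert_edge h1 hfS b' hs hr hsv hrv
    refine ⟨σ'', h1', hU', ?_⟩
    have := h2' hsr
    omega

namespace IsTreeFrom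

variable {r : V}

/-- Pendant edges preserve the single face; the trivial tree is separate because it has no darts. -/
theorem hasRotation (h : IsTreeFrom v r U S) : (U = {r} ∧ S = ∅) ∨ HasRotation v S U 1 := by
  induction h with
  | single => exact Or.inl ⟨rfl, rfl⟩
  | grow h hx hy he ih =>
    right
    rcases ih with ⟨rfl, rfl⟩ | ih
    · obtain rfl := Set.mem_singleton_iff.1 hx
      rw [insert_empty_eq]
      exact hasRotation_singleton he fun h => hy h.symm
    · exact ih.insert_pendant he hx hy

theorem hasRotation_insert (h : IsTreeFrom v r U S) {e : E} {x y : V} (he : Links v e x y)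
    (hx : x ∈ U) (hy : y ∉ U) : HasRotation v (insert e S) (insert y U) 1 := by
  rcases (h.grow hx hy he).hasRotation with ⟨h1, -⟩ | h1
  · exfalso
    have h2 : y = r := by rw [← Set.mem_singleton_iff, ← h1]; exact Set.mem_insert _ _
    exact hy (h2 ▸ h.root_mem)
  · exact h1

end IsTreeFrom

end RotationSystem

/-! ### Adding many edges: two trees joined by cross edges -/

namespace RotationSystem

open Equiv Equiv.Perm

variable {E V : Type*} {v : E × Bool → V} {S : Finset E} {U : Set V}

theorem Links.eq_or_eq {e : E} {x y x' y' : V} (h : Links v e x y) (h' : Links v e x' y') :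
    x = x' ∨ x = y' := by
  obtain ⟨b, rfl, rfl⟩ := h
  obtain ⟨b', rfl, rfl⟩ := h'
  cases b <;> cases b' <;> simp

variable [DecidableEq E]

theorem HasRotation.mono {k l : ℕ} (h : HasRotation v S U k) (hkl : k ≤ l) :
    HasRotation v S U l := by
  obtain ⟨σ, h1, h2, h3⟩ := h
  exact ⟨σ, h1, h2, by omega⟩

variable [Finite E]

/-- Edges at a common vertex `a` are added two at a time by `insert_insert`. -/
theorem HasRotation.union_even {k n : ℕ} (h : HasRotation v S U k) {Q : Finset E}
    (hQ : Q.card = 2 * n) (hdis : ∀ e ∈ Q, e ∉ S) {a : V} (ha : a ∈ U)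
    (hlink : ∀ e ∈ Q, ∃ y ∈ U, Links v e a y) : HasRotation v (S ∪ Q) U k := by
  induction n generalizing Q with
  | zero =>
    rw [mul_zero, Finset.card_eq_zero] at hQ
    rwa [hQ, Finset.union_empty]
  | succ n ih =>
    obtain ⟨e, he⟩ : Q.Nonempty := Finset.card_pos.1 (by omega)
    have h1 := Finset.card_erase_of_mem he
    obtain ⟨f, hf⟩ : (Q.erase e).Nonempty := Finset.card_pos.1 (by omega)
    have h2 := Finset.card_erase_of_mem hf
    have hsub : ∀ g ∈ (Q.erase e).erase f, g ∈ Q := fun g hg =>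
      Finset.mem_of_mem_erase (Finset.mem_of_mem_erase hg)
    have hfQ := Finset.mem_of_mem_erase hf
    have h3 := ih (Q := (Q.erase e).erase f) (by omega) (fun g hg => hdis g (hsub g hg))
      (fun g hg => hlink g (hsub g hg))
    obtain ⟨y, hy, hey⟩ := hlink e he
    obtain ⟨z, hz, hfz⟩ := hlink f hfQ
    have h4 := h3.insert_insert (e := e) (f := f) (by simp [hdis e he])
      (by simp [hdis f hfQ, (Finset.mem_erase.1 hf).1]) hey hfz ha hy hz
    rwa [← Finset.union_insert, ← Finset.union_insert, Finset.insert_comm,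
      Finset.insert_erase hf, Finset.insert_erase he] at h4

theorem HasRotation.union_star {k : ℕ} (h : HasRotation v S U k) {Q : Finset E}
    (hdis : ∀ e ∈ Q, e ∉ S) {a : V} (ha : a ∈ U)
    (hlink : ∀ e ∈ Q, ∃ y ∈ U, Links v e a y) : HasRotation v (S ∪ Q) U (k + 1) := by
  obtain ⟨n, hn | hn⟩ := Nat.even_or_odd' Q.card
  · exact (h.union_even hn hdis ha hlink).mono (by omega)
  · obtain ⟨e, he⟩ : Q.Nonempty := Finset.card_pos.1 (by omega)
    have h1 := Finset.card_erase_of_mem he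
    have hsub : ∀ g ∈ Q.erase e, g ∈ Q := fun g hg => Finset.mem_of_mem_erase hg
    have h2 := h.union_even (Q := Q.erase e) (n := n) (by omega) (fun g hg => hdis g (hsub g hg)) ha
      (fun g hg => hlink g (hsub g hg))
    obtain ⟨y, hy, hey⟩ := hlink e he
    have h3 := h2.insert_edge (e := e) (by simp [hdis e he]) hey ha hy
    rwa [← Finset.union_insert, Finset.insert_erase he] at h3

theorem HasRotation.union {k : ℕ} (h : HasRotation v S U k) {Q : Finset E}
    (hdis : ∀ e ∈ Q, e ∉ S) (hlink : ∀ e ∈ Q, ∃ x ∈ U, ∃ y ∈ U, Links v e x y) :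
    HasRotation v (S ∪ Q) U (k + Q.card) := by
  induction Q using Finset.induction_on with
  | empty => simpa using h
  | insert e Q he ih =>
    have h1 := ih (fun f hf => hdis f (Finset.mem_insert_of_mem hf))
      (fun f hf => hlink f (Finset.mem_insert_of_mem hf))
    obtain ⟨x, hx, y, hy, hxy⟩ := hlink e (Finset.mem_insert_self _ _)
    have h2 := h1.insert_edge (e := e)
      (by simp [he, hdis e (Finset.mem_insert_self _ _)]) hxy hx hy
    rwa [← Finset.union_insert, add_assoc, ← Finset.card_insert_of_notMem he] at h2

/-- A graph whose vertices are partitioned into the vertex sets of two trees, all other edges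
running between these trees, has a rotation system with at most two faces. -/
theorem IsTreeFrom.hasRotation_union {r r' : V} {A B : Set V} {SA SB C : Finset E}
    (hA : IsTreeFrom v r A SA) (hB : IsTreeFrom v r' B SB) (hAB : Disjoint A B)
    (hC : ∀ e ∈ C, ∃ x ∈ A, ∃ y ∈ B, Links v e x y) (hr : ∃ e ∈ C, ∃ y ∈ B, Links v e r y) :
    HasRotation v (SA ∪ SB ∪ C) (A ∪ B) 2 := by
  classical
  induction hA generalizing r' B SB C with
  -- One cross edge hangs `r` onto the tree of `B`, giving a tree with one face. The others form a
  -- star at `r`, whose possible unpaired edge accounts for the second face.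
  | single =>
    obtain ⟨c, hc, y, hy, hcy⟩ := hr
    have hrB : r ∉ B := fun h => (Set.disjoint_left.1 hAB) rfl h
    have h1 := hB.hasRotation_insert hcy.symm hy hrB
    have h2 := h1.union_star (Q := C.erase c) (a := r) ?_ (Set.mem_insert _ _) ?_
    · rwa [Finset.insert_union, ← Finset.union_insert, Finset.insert_erase hc,
        ← Set.singleton_union, ← Finset.empty_union SB] at h2
    · intro e he
      obtain ⟨x, rfl, z, hz, hez⟩ := hC e (Finset.mem_of_mem_erase he)
      simp only [Finset.mem_insert, not_or]
      exact ⟨Finset.ne_of_mem_erase he, hB.notMem hez.symm hrB⟩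
    · intro e he
      obtain ⟨x, rfl, z, hz, hez⟩ := hC e (Finset.mem_of_mem_erase he)
      exact ⟨z, Or.inr hz, hez⟩
  | @grow U S e x y hU hx hy he ih =>
    have hyB : y ∉ B := fun h => Set.disjoint_left.1 hAB (Set.mem_insert _ _) h
    have hUB : Disjoint U B := hAB.mono_left (Set.subset_insert _ _)
    have hA := hU.grow hx hy he
    -- Split the cross edges into those at the last leaf `y` and the rest; the parity of the first
    -- set decides on which side `y` is placed.
    set Ca := C.filter (fun f => ∃ z ∈ B, Links v f y z) with hCa
    set C' := C.filter (fun f => ¬ ∃ z ∈ B, Links v f y z) with hC'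
    have hCC : Ca ∪ C' = C := Finset.filter_union_filter_not_eq _ _
    have hCaU : ∀ f ∈ Ca, f ∉ insert e S ∧ f ∉ SB ∧ f ∉ C' := by
      intro f hf
      obtain ⟨hfC, z, hz, hfz⟩ := Finset.mem_filter.1 hf
      refine ⟨hA.notMem hfz fun h => Set.disjoint_left.1 hAB h hz, hB.notMem hfz.symm hyB, ?_⟩
      intro hf'
      exact (Finset.mem_filter.1 hf').2 ⟨z, hz, hfz⟩
    have hC'U : ∀ f ∈ C', ∃ x ∈ U, ∃ y ∈ B, Links v f x y := by
      intro f hf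
      obtain ⟨hfC, hfn⟩ := Finset.mem_filter.1 hf
      obtain ⟨x', (rfl | hx'), z, hz, hfz⟩ := hC f hfC
      · exact absurd ⟨z, hz, hfz⟩ hfn
      · exact ⟨x', hx', z, hz, hfz⟩
    -- A cross edge at the root has its other end in `B`, so it does not meet `y` and survives the
    -- removal of `y`.
    have hr' : ∃ f ∈ C', ∃ y ∈ B, Links v f r y := by
      obtain ⟨f, hf, z, hz, hfz⟩ := hr
      refine ⟨f, Finset.mem_filter.2 ⟨hf, ?_⟩, z, hz, hfz⟩
      rintro ⟨z', hz', hfz'⟩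
      rcases hfz'.eq_or_eq hfz with h | h
      · exact hy (h ▸ hU.root_mem)
      · exact hyB (h ▸ hz)
    obtain ⟨n, hn | hn⟩ := Nat.even_or_odd' Ca.card
    · have h1 := (ih hB hUB hC'U hr').insert_pendant he (Or.inl hx)
        (by rintro (h | h); exacts [hy h, hyB h])
      have h2 := h1.union_even hn ?_ (Set.mem_insert _ _) ?_
      · convert h2 using 1
        · rw [← hCC]; ext f; simp only [Finset.mem_union, Finset.mem_insert]; tauto
        · rw [Set.insert_union]
      · intro f hf
        have := hCaU f hf
        simp only [Finset.mem_union, Finset.mem_insert] at this ⊢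
        tauto
      · intro f hf
        obtain ⟨hfC, z, hz, hfz⟩ := Finset.mem_filter.1 hf
        exact ⟨z, Or.inr (Or.inr hz), hfz⟩
    -- Odd case: `y` joins the tree of `B` through `c`, and its old tree edge `e` becomes a cross
    -- edge. An even number of edges at `y` remains.
    · obtain ⟨c, hc⟩ : Ca.Nonempty := Finset.card_pos.1 (by omega)
      have hcard := Finset.card_erase_of_mem hc
      obtain ⟨-, z, hz, hcz⟩ := Finset.mem_filter.1 hc
      have hB' := hB.grow hz hyB hcz.symm
      have h1 := ih (C := insert e C') hB' ?_ ?_ ?_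
      · have h2 := h1.union_even (Q := Ca.erase c) (n := n) (by omega) ?_
          (Or.inr (Set.mem_insert y _)) ?_
        · convert h2 using 1
          · rw [← hCC, ← Finset.insert_erase hc]
            ext f; simp only [Finset.mem_union, Finset.mem_insert, Finset.mem_erase]; tauto
          · rw [Set.insert_union, Set.union_insert]
        · intro f hf
          have h3 := hCaU f (Finset.mem_of_mem_erase hf)
          have h4 := Finset.ne_of_mem_erase hf
          simp only [Finset.mem_union, Finset.mem_insert] at h3 ⊢
          tauto
        · intro f hf
          obtain ⟨hfC, z, hz, hfz⟩ := Finset.mem_filter.1 (Finset.mem_of_mem_erase hf)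
          exact ⟨z, Or.inr (Or.inr hz), hfz⟩
      · rw [Set.disjoint_insert_right]
        exact ⟨hy, hUB⟩
      · intro f hf
        rcases Finset.mem_insert.1 hf with rfl | hf
        · exact ⟨x, hx, y, Set.mem_insert _ _, he⟩
        · obtain ⟨x, hx, z, hz, hxz⟩ := hC'U f hf
          exact ⟨x, hx, z, Or.inr hz, hxz⟩
      · obtain ⟨f, hf, z, hz, hfz⟩ := hr'
        exact ⟨f, Finset.mem_insert_of_mem hf, z, Or.inr hz, hfz⟩

end RotationSystem

/-! ### From rotation systems to orientable embeddings and the maximum genus -/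

namespace RotationSystem

open Equiv Equiv.Perm

theorem sign_flip {E : Type*} [DecidableEq E] [Fintype E] (S : Finset E) :
    sign (flip S) = (-1) ^ S.card := by
  induction S using Finset.induction_on with
  | empty =>
    have : flip (∅ : Finset E) = 1 := by ext1 d; exact flip_of_notMem (by simp)
    simp [this]
  | insert e S he ih =>
    rw [flip_insert he false, Perm.sign_mul, ih, sign_swap (by simp), Finset.card_insert_of_notMem he,
      pow_succ]

/-- Compare signs in the definition of `facePerm`: `flip S` is a product of `S.card` transpositions,
and the number of darts cancels. For all edges, this is the evenness of the Euler characteristic. -/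
theorem even_numOrbits_facePerm {E : Type*} [DecidableEq E] [Fintype E] (S : Finset E)
    (σ : Perm (E × Bool)) : Even (numOrbits σ + S.card + numOrbits (facePerm S σ)) := by
  have h : sign (facePerm S σ) = sign σ * sign (flip S) := by
    rw [facePerm, Perm.sign_mul, sign_inv]
  rw [sign_eq_neg_one_pow_numOrbits, sign_eq_neg_one_pow_numOrbits σ, sign_flip, pow_add,
    pow_add, mul_assoc] at h
  have h := mul_left_cancel h
  by_contra hodd
  rw [Nat.not_even_iff_odd] at hodd
  have h1 := hodd.neg_one_pow (α := ℤˣ)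
  rw [pow_add, h, pow_add, Int.units_mul_self] at h1
  exact absurd h1 (by decide)

variable {α β : Type*} {G : Graph α β} {m : ℕ} {v : Fin m × Bool → α}
  {σ : Perm (Fin m × Bool)}

/-- The orientable cellular embedding given by a rotation system.  The flags `(d, true)` and
`(d, false)` lie on the two sides of the dart `d`, towards `σ d` and `σ⁻¹ d`, respectively. -/
noncomputable def cellularEmbedding (ι : Fin m ≃ G.edgeSet)
    (hv : ∀ e, G.IsLink (ι e) (v (e, false)) (v (e, true)))
    (hσ : ∀ d d', σ.SameCycle d d' ↔ v d = v d') : G.CellularEmbedding where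
  Flag := (Fin m × Bool) × Bool
  finite_flag := inferInstance
  vertex f := v f.1
  edge f := ι f.1.1
  swapVertex f := ((f.1.1, !f.1.2), !f.2)
  swapEdge f := (if f.2 then σ f.1 else σ⁻¹ f.1, !f.2)
  swapFace f := (f.1, !f.2)
  swapVertex_swapVertex := by rintro ⟨⟨e, b⟩, s⟩; simp
  swapEdge_swapEdge := by rintro ⟨d, s⟩; cases s <;> simp
  swapFace_swapFace := by rintro ⟨d, s⟩; simp
  swapVertex_ne := by rintro ⟨⟨e, b⟩, s⟩; simp
  swapEdge_ne := by rintro ⟨d, s⟩; simp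
  swapFace_ne := by rintro ⟨d, s⟩; simp
  swapVertex_swapFace := by rintro ⟨⟨e, b⟩, s⟩; simp
  swapVertex_ne_swapFace := by rintro ⟨⟨e, b⟩, s⟩; simp
  isLink := by
    rintro ⟨⟨e, b⟩, s⟩
    cases b
    · exact hv e
    · exact (hv e).symm
  exists_edge_eq := by
    intro e he
    exact ⟨((ι.symm ⟨e, he⟩, false), false), by simp⟩
  edge_swapVertex := by rintro ⟨⟨e, b⟩, s⟩; rfl
  edge_swapFace := by rintro ⟨⟨e, b⟩, s⟩; rfl
  eq_of_edge_eq := by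
    rintro ⟨⟨e, b⟩, s⟩ ⟨⟨e', b'⟩, s'⟩ h
    have h' : e = e' := ι.injective (Subtype.ext h)
    subst h'
    cases b <;> cases s <;> cases b' <;> cases s' <;> simp
  vertex_swapEdge := by
    rintro ⟨d, s⟩
    refine (hσ _ _).1 ?_
    cases s
    · exact sameCycle_inv.1 (sameCycle_apply_left.2 (SameCycle.refl _ _))
    · exact sameCycle_apply_left.2 (SameCycle.refl _ _)
  vertex_swapFace := by rintro ⟨d, s⟩; rfl
  reach_of_vertex_eq := by
    rintro ⟨d, s⟩ ⟨d', s'⟩ h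
    obtain ⟨n, rfl⟩ := ((hσ d d').2 h).exists_nat_pow_eq
    have hs : ∀ (d : Fin m × Bool) (s t : Bool), Relation.ReflTransGen
        (fun a b : (Fin m × Bool) × Bool =>
          b = (if a.2 then σ a.1 else σ⁻¹ a.1, !a.2) ∨ b = (a.1, !a.2)) (d, s) (d, t) := by
      intro d s t
      by_cases hst : s = t
      · rw [hst]
      · refine Relation.ReflTransGen.single (Or.inr ?_)
        cases s <;> cases t <;> simp_all
    induction n generalizing s' with
    | zero => exact hs d s s'
    | succ n ih =>
      refine (ih true ?_).trans (Relation.ReflTransGen.head (Or.inl rfl) ?_)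
      · refine (hσ _ _).1 ?_
        exact sameCycle_pow_right.2 (SameCycle.refl _ _)
      · rw [pow_succ']
        exact hs _ _ s'

section

variable (ι : Fin m ≃ G.edgeSet) (hv : ∀ e, G.IsLink (ι e) (v (e, false)) (v (e, true)))
  (hσ : ∀ d d', σ.SameCycle d d' ↔ v d = v d')

theorem isOrientable_cellularEmbedding : (cellularEmbedding ι hv hσ).IsOrientable :=
  ⟨fun f => f.2, fun _ => ⟨Bool.not_ne_self _, Bool.not_ne_self _, Bool.not_ne_self _⟩⟩

/-- `swapVertex` followed by `swapEdge` takes `(d, true)` to `(φ d, true)`, and every flag on the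
`false` side is glued by `swapVertex` to one on the `true` side. So faces are orbits of `φ`. -/
theorem card_face_cellularEmbedding :
    Nat.card (cellularEmbedding ι hv hσ).Face = numOrbits (facePerm Finset.univ σ) := by
  set M := cellularEmbedding ι hv hσ
  set φ := facePerm Finset.univ σ with hφ
  have hflip : ∀ d : Fin m × Bool, flip Finset.univ d = (d.1, !d.2) := fun d =>
    flip_of_mem (Finset.mem_univ _)
  have hφd : ∀ d : Fin m × Bool, φ d = σ⁻¹ (d.1, !d.2) := fun d => by
    rw [hφ, facePerm, mul_apply, hflip]
  have hsv : ∀ f : M.Flag, M.face (M.swapVertex f) = M.face f := M.face_swapVertex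
  have hse : ∀ f : M.Flag, M.face (M.swapEdge f) = M.face f := fun f =>
    (Quot.sound (r := fun a b : M.Flag => b = M.swapVertex a ∨ b = M.swapEdge a)
      (Or.inr rfl)).symm
  have hstep : ∀ d : Fin m × Bool, M.face (φ d, true) = M.face (d, true) := by
    intro d
    rw [hφd, ← hsv (d, true), ← hse (M.swapVertex (d, true))]
    rfl
  symm
  refine Nat.card_congr
    { toFun := Quotient.lift (fun d => M.face (d, true)) ?_
      invFun := Quot.lift (fun f : M.Flag => Quotient.mk (SameCycle.setoid φ)
        (if f.2 then f.1 else (f.1.1, !f.1.2))) ?_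
      left_inv := ?_
      right_inv := ?_ }
  · intro x y hxy
    exact (SameCycle.iff_of_forall_apply (p := fun z => M.face (x, true) = M.face (z, true))
      (fun z => by rw [hstep]) hxy).1 rfl
  · rintro ⟨⟨e, b⟩, s⟩ f (rfl | rfl)
    · apply Quotient.sound
      cases s
      · exact SameCycle.refl φ _
      · change φ.SameCycle (e, b) (e, !!b)
        rw [Bool.not_not]
    · apply Quotient.sound
      cases s
      · change φ.SameCycle (e, !b) (σ⁻¹ (e, b))
        rw [← sameCycle_apply_left, hφd]
        simp [SameCycle.refl]
      · change φ.SameCycle (e, b) ((σ (e, b)).1, !(σ (e, b)).2)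
        rw [← sameCycle_apply_right, hφd]
        simp [SameCycle.refl]
  · intro q
    induction q using Quotient.inductionOn with
    | h d => rfl
  · intro q
    induction q using Quot.ind with
    | mk f =>
      obtain ⟨d, s⟩ := f
      cases s
      · exact hsv (d, false)
      · rfl

end

/-- A rotation system with at most `k` faces bounds the maximum genus from below. -/
theorem HasRotation.bettiNumber_le {k : ℕ} (hm : 0 < m) (ι : Fin m ≃ G.edgeSet)
    (hv : ∀ e, G.IsLink (ι e) (v (e, false)) (v (e, true)))
    (h : HasRotation v Finset.univ G.vertexSet k) :
    G.bettiNumber + 1 - k ≤ 2 * (G.maxGenus : ℤ) := by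
  obtain ⟨σ, hσ, hU, ho⟩ := h
  have hσ' : ∀ d d', σ.SameCycle d d' ↔ v d = v d' := fun d d' =>
    hσ.sameCycle_iff d (mem_darts.2 (Finset.mem_univ _)) d' (mem_darts.2 (Finset.mem_univ _))
  have hcard : Nat.card (Fin m × Bool) = 2 * m := by simp [mul_comm]
  rw [hcard, Finset.card_univ, Fintype.card_fin] at ho
  have hE : G.edgeSet.ncard = m := by
    rw [← Nat.card_coe_set_eq, ← Nat.card_congr ι, Nat.card_fin]
  have hmem : ∀ d, v d ∈ G.vertexSet := fun d => hU ▸ ⟨d, mem_darts.2 (Finset.mem_univ _), rfl⟩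
  have hV : G.vertexSet.ncard = numOrbits σ := by
    symm
    rw [← Nat.card_coe_set_eq]
    refine Nat.card_eq_of_bijective (Quotient.lift (fun d => (⟨v d, hmem d⟩ : G.vertexSet))
      fun x y hxy => Subtype.ext ((hσ' x y).1 hxy)) ⟨?_, ?_⟩
    · intro p q
      induction p using Quotient.inductionOn with
      | h x =>
        induction q using Quotient.inductionOn with
        | h y => exact fun hxy => Quotient.sound ((hσ' x y).2 (congrArg Subtype.val hxy))
    · rintro ⟨x, hx⟩
      rw [← hU] at hx
      obtain ⟨d, -, rfl⟩ := hx
      exact ⟨Quotient.mk _ d, rfl⟩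
  have hpar := even_numOrbits_facePerm Finset.univ σ
  rw [Finset.card_univ, Fintype.card_fin] at hpar
  set o := numOrbits (facePerm Finset.univ σ) with ho'
  have hχ : (cellularEmbedding ι hv hσ').eulerChar = (numOrbits σ : ℤ) - m + o := by
    have hne : ¬ IsEmpty (cellularEmbedding ι hv hσ').Flag := by
      rw [not_isEmpty_iff]
      exact ⟨((⟨0, hm⟩, true), true)⟩
    rw [Graph.CellularEmbedding.eulerChar, Graph.CellularEmbedding.numFaces, if_neg hne,
      card_face_cellularEmbedding, hV, hE]
  rw [Graph.bettiNumber, hE, hV]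
  obtain ⟨t, ht⟩ := hpar
  -- Proving that the Euler characteristic is at most 2 is avoided: were it larger, the left-hand
  -- side of the goal would be negative.
  by_cases hbig : (numOrbits σ : ℤ) - m + o ≤ 2
  · obtain ⟨g, hg⟩ : ∃ g : ℕ, (numOrbits σ : ℤ) - m + o = 2 - 2 * (g : ℤ) :=
      -- By parity |V| + m + o = 2t, so the Euler characteristic is 2t - 2m.
      ⟨(1 + m - t : ℤ).toNat, by omega⟩
    have hle : g ≤ G.maxGenus := le_csSup (Graph.bddAbove_genus G)
      ⟨cellularEmbedding ι hv hσ', isOrientable_cellularEmbedding ι hv hσ', hχ.trans hg⟩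
    omega
  · omega

end RotationSystem

/-! ### The two sides of a separating Hamiltonian cycle of the dual -/

theorem Finset.even_card_of_involutive {ι : Type*} (s : Finset ι) (g : ι → ι)
    (hg : ∀ a, g (g a) = a) (hne : ∀ a, g a ≠ a) (hs : ∀ a ∈ s, g a ∈ s) : Even s.card := by
  have h : ∑ a ∈ s, (1 : ZMod 2) = 0 :=
    Finset.sum_involution (fun a _ => g a) (fun _ _ => by decide) (fun a _ _ => hne a)
      (fun a ha => hs a ha) (fun a _ => hg a)
  rw [Finset.sum_const, nsmul_one] at h
  exact (ZMod.natCast_eq_zero_iff_even).1 h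

namespace Graph.CellularEmbedding

variable {α β : Type*} {G : Graph α β} (M : G.CellularEmbedding)

theorem face_swapEdge (f : M.Flag) : M.face (M.swapEdge f) = M.face f :=
  (Quot.sound (r := fun a b : M.Flag => b = M.swapVertex a ∨ b = M.swapEdge a) (Or.inr rfl)).symm

/-- The predicate `p` is constant along the sides of triangles off the curve given by `C`. -/
structure IsClosedOff (C : Set β) (p : M.Flag → Prop) : Prop where
  swapEdge_iff : ∀ a, p (M.swapEdge a) ↔ p a
  swapFace_iff : ∀ a, p (M.swapFace a) ↔ p a
  swapVertex_iff : ∀ a, M.edge a ∉ C → (p (M.swapVertex a) ↔ p a)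

variable {M} {C : Set β} {p q : M.Flag → Prop}

theorem isClosedOff_reach (f : M.Flag) :
    M.IsClosedOff C (fun g => Relation.ReflTransGen (M.GluedOff C) f g) := by
  refine ⟨fun a => ⟨fun h => ?_, fun h => h.tail (Or.inl rfl)⟩,
    fun a => ⟨fun h => ?_, fun h => h.tail (Or.inr (Or.inl rfl))⟩,
    fun a ha => ⟨fun h => ?_, fun h => h.tail (Or.inr (Or.inr ⟨ha, rfl⟩))⟩⟩
  · exact h.tail (Or.inl (M.swapEdge_swapEdge a).symm)
  · exact h.tail (Or.inr (Or.inl (M.swapFace_swapFace a).symm))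
  · exact h.tail (Or.inr (Or.inr ⟨by rwa [M.edge_swapVertex], (M.swapVertex_swapVertex a).symm⟩))

theorem IsClosedOff.iff_of_reach (hp : M.IsClosedOff C p) {f g : M.Flag}
    (h : Relation.ReflTransGen (M.GluedOff C) f g) : p f ↔ p g := by
  induction h with
  | refl => rfl
  | tail _ hs ih =>
    rw [ih]
    rcases hs with rfl | rfl | ⟨hC, rfl⟩
    · exact (hp.swapEdge_iff _).symm
    · exact (hp.swapFace_iff _).symm
    · exact (hp.swapVertex_iff _ hC).symm

/-- The flags around a vertex are joined without passing through any dual edge, so each vertex lies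
on one side of the curve. -/
theorem IsClosedOff.iff_of_vertex_eq (hp : M.IsClosedOff C p) {f g : M.Flag}
    (h : M.vertex f = M.vertex g) : p f ↔ p g := by
  refine hp.iff_of_reach (Relation.ReflTransGen.mono ?_ _ _ (M.reach_of_vertex_eq f g h))
  rintro a b (h | h)
  · exact Or.inl h
  · exact Or.inr (Or.inl h)

theorem exists_flag_of_isLink {b : β} {x y : α} (h : G.IsLink b x y) :
    ∃ f, M.edge f = b ∧ M.vertex f = x ∧ M.vertex (M.swapVertex f) = y := by
  obtain ⟨f, rfl⟩ := M.exists_edge_eq b h.edge_mem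
  rcases (M.isLink f).eq_and_eq_or_eq_and_eq h with ⟨h1, h2⟩ | ⟨h1, h2⟩
  · exact ⟨f, rfl, h1, h2⟩
  · exact ⟨M.swapVertex f, M.edge_swapVertex f, h2, by rw [M.swapVertex_swapVertex, h1]⟩

/-- With no curve removed, `p` spreads around each vertex and along each edge, hence over all of the
connected graph. -/
theorem IsClosedOff.forall_of_isConnected (hG : G.IsConnected) (hp : M.IsClosedOff ∅ p)
    {f : M.Flag} (hf : p f) (g : M.Flag) : p g := by
  have key : ∀ y, Relation.ReflTransGen G.Adj (M.vertex f) y → ∀ h, M.vertex h = y → p h := by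
    intro y hy
    induction hy with
    | refl => exact fun h hh => (hp.iff_of_vertex_eq hh.symm).1 hf
    | tail _ hs ih =>
      obtain ⟨b, hb⟩ := hs
      obtain ⟨k, -, h1, h2⟩ := exists_flag_of_isLink (M := M) hb
      intro h hh
      rw [hp.iff_of_vertex_eq (hh.trans h2.symm), hp.swapVertex_iff k (Set.notMem_empty _)]
      exact ih k h1
  exact key _ (hG.2 _ (M.isLink f).left_mem _ (M.isLink g).left_mem) g rfl

theorem exists_vertex_eq (hG : G.IsConnected) (f : M.Flag) {y : α} (hy : y ∈ G.vertexSet) :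
    ∃ h, M.vertex h = y := by
  rcases Relation.ReflTransGen.cases_tail (hG.2 _ (M.isLink f).left_mem _ hy) with h | ⟨z, -, h⟩
  · exact ⟨f, h.symm⟩
  · obtain ⟨b, hb⟩ := h
    obtain ⟨k, -, -, h2⟩ := exists_flag_of_isLink (M := M) hb
    exact ⟨_, h2⟩

section Hamiltonian

variable {n : ℕ} {x : Fin (n + 1) → M.Face} {e : Fin (n + 1) → β}

/-- In a face that meets the curve in two half-edges only, the curve crosses between `p` and its
complement at both of these or at none. -/
theorem IsClosedOff.cross_iff_cross (hp : M.IsClosedOff C p) {a b : M.Flag}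
    (hab : M.edge a ≠ M.edge b) (ha : M.edge a ∈ C) (hb : M.edge b ∈ C)
    (hface : M.face a = M.face b)
    (hC : ∀ g, M.face g = M.face b → M.edge g ∈ C →
      g = a ∨ g = M.swapVertex a ∨ g = b ∨ g = M.swapVertex b) :
    (p a ↔ p (M.swapVertex a)) ↔ (p b ↔ p (M.swapVertex b)) := by
  classical
  have := M.finite_flag
  have := Fintype.ofFinite M.Flag
  -- Parity count: `swapEdge` pairs the flags of the face that satisfy `p`, and `swapVertex` pairs
  -- those off the curve. So an even number of the four flags on the curve satisfies `p`.
  let S : Finset M.Flag := Finset.univ.filter fun g => M.face g = M.face b ∧ p g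
  have h1 : Even S.card := by
    refine S.even_card_of_involutive M.swapEdge M.swapEdge_swapEdge M.swapEdge_ne fun g hg => ?_
    simp only [S, Finset.mem_filter, Finset.mem_univ, true_and] at hg ⊢
    rwa [face_swapEdge, hp.swapEdge_iff]
  have h2 : Even (S.filter fun g => ¬ M.edge g ∈ C).card := by
    refine Finset.even_card_of_involutive _ M.swapVertex M.swapVertex_swapVertex M.swapVertex_ne
      fun g hg => ?_
    simp only [S, Finset.mem_filter, Finset.mem_univ, true_and] at hg ⊢
    rw [face_swapVertex, hp.swapVertex_iff g hg.2, M.edge_swapVertex]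
    exact hg
  have h3 : S.filter (fun g => M.edge g ∈ C) =
      ({a, M.swapVertex a, b, M.swapVertex b} : Finset M.Flag).filter p := by
    ext g
    simp only [S, Finset.mem_filter, Finset.mem_univ, true_and, Finset.mem_insert,
      Finset.mem_singleton]
    constructor
    · rintro ⟨⟨hg1, hg2⟩, hg3⟩
      exact ⟨hC g hg1 hg3, hg2⟩
    · rintro ⟨rfl | rfl | rfl | rfl, hg⟩
      · exact ⟨⟨hface, hg⟩, ha⟩
      · exact ⟨⟨by rw [face_swapVertex, hface], hg⟩, by rwa [M.edge_swapVertex]⟩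
      · exact ⟨⟨rfl, hg⟩, hb⟩
      · exact ⟨⟨by rw [face_swapVertex], hg⟩, by rwa [M.edge_swapVertex]⟩
  have h4 := Finset.card_filter_add_card_filter_not (s := S) (fun g => M.edge g ∈ C)
  rw [← h4, h3, Nat.even_add] at h1
  have h5 := h1.2 h2
  have n1 : a ≠ M.swapVertex a := (M.swapVertex_ne a).symm
  have n2 : b ≠ M.swapVertex b := (M.swapVertex_ne b).symm
  have n3 : a ≠ b := fun h => hab (by rw [h])
  have n4 : a ≠ M.swapVertex b := fun h => hab (by rw [h, M.edge_swapVertex])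
  have n5 : M.swapVertex a ≠ b := fun h => hab (by rw [← h, M.edge_swapVertex])
  have n6 : M.swapVertex a ≠ M.swapVertex b := fun h => hab (by
    rw [← M.edge_swapVertex a, h, M.edge_swapVertex])
  by_cases pa : p a <;> by_cases pa' : p (M.swapVertex a) <;> by_cases pb : p b <;>
    by_cases pb' : p (M.swapVertex b) <;>
    simp [Finset.filter_insert, Finset.filter_singleton, pa, pa', pb, pb', n1, n2, n3, n4, n5, n6]
      at h5 ⊢ <;> revert h5 <;> decide

/-- Whether the curve edge separates `p` from its complement is passed on from face to face around
the cycle. If no edge did, `p` would be constant on the surface. -/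
theorem IsClosedOff.swapVertex_iff_not (hG : G.IsConnected) (hC : M.dual.IsHamiltonianCycle x e)
    (hp : M.IsClosedOff (Set.range e) p) {f g : M.Flag} (hf : p f) (hg : ¬ p g) {h : M.Flag}
    (hh : M.edge h ∈ Set.range e) : p (M.swapVertex h) ↔ ¬ p h := by
  have hlink : ∀ i, ∃ f, M.edge f = e i ∧ M.face f = x i ∧ M.face (M.swapFace f) = x (i + 1) :=
    fun i => hC.isLink i
  choose F hFe hFx hFx' using hlink
  have four : ∀ j h, M.edge h = e j → h = F j ∨ h = M.swapVertex (F j) ∨ h = M.swapFace (F j) ∨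
      h = M.swapVertex (M.swapFace (F j)) := fun j h hj =>
    M.eq_of_edge_eq (F j) h ((hFe j).trans hj.symm)
  -- Injectivity of the cycle leaves only the halves of `e i` and `e (i + 1)` in the face `x (i +
  -- 1)`. The hypothesis excludes the loop, for which there is nothing to propagate.
  have hstep : ∀ i : Fin (n + 1), i ≠ i + 1 → ((p (F i) ↔ p (M.swapVertex (F i))) ↔
      (p (F (i + 1)) ↔ p (M.swapVertex (F (i + 1))))) := by
    intro i hi
    rw [← hp.swapFace_iff (F i), ← hp.swapFace_iff (M.swapVertex (F i)),
      ← M.swapVertex_swapFace]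
    refine hp.cross_iff_cross ?_ ?_ ?_ ?_ ?_
    · rw [M.edge_swapFace, hFe, hFe]
      exact fun h => hi (hC.edge_injective h)
    · rw [M.edge_swapFace, hFe]; exact ⟨i, rfl⟩
    · rw [hFe]; exact ⟨_, rfl⟩
    · rw [hFx', hFx]
    · rintro g hg ⟨j, hj⟩
      rw [hFx] at hg
      rcases four j g hj.symm with h | h | h | h
      · rw [h, hFx] at hg
        rw [← hC.vertex_injective hg]; tauto
      · rw [h, face_swapVertex, hFx] at hg
        rw [← hC.vertex_injective hg]; tauto
      · rw [h, hFx'] at hg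
        rw [← add_right_cancel (hC.vertex_injective hg)]; tauto
      · rw [h, face_swapVertex, hFx'] at hg
        rw [← add_right_cancel (hC.vertex_injective hg)]; tauto
  have hall : ∀ i, ((p (F i) ↔ p (M.swapVertex (F i))) ↔ (p (F 0) ↔ p (M.swapVertex (F 0)))) := by
    intro i
    induction i using Fin.induction with
    | zero => rfl
    | succ i ih =>
      have h1 := hstep i.castSucc
      rw [Fin.coeSucc_eq_succ] at h1
      rw [← ih]
      exact (h1 (Fin.castSucc_lt_succ).ne).symm
  have hflag : ∀ j h, M.edge h = e j →
      ((p h ↔ p (M.swapVertex h)) ↔ (p (F j) ↔ p (M.swapVertex (F j)))) := by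
    intro j h hj
    rcases four j h hj with rfl | rfl | rfl | rfl
    · rfl
    · rw [M.swapVertex_swapVertex, iff_comm (a := p (M.swapVertex _))]
    · rw [M.swapVertex_swapFace, hp.swapFace_iff, hp.swapFace_iff]
    · rw [M.swapVertex_swapVertex, M.swapVertex_swapFace, hp.swapFace_iff, hp.swapFace_iff,
        iff_comm (a := p (M.swapVertex _))]
  by_cases h0 : p (F 0) ↔ p (M.swapVertex (F 0))
  · refine absurd ?_ hg
    refine IsClosedOff.forall_of_isConnected hG ⟨hp.swapEdge_iff, hp.swapFace_iff, ?_⟩ hf g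
    intro k _
    by_cases hk : M.edge k ∈ Set.range e
    · obtain ⟨j, hj⟩ := hk
      exact ((hflag j k hj.symm).2 ((hall j).2 h0)).symm
    · exact hp.swapVertex_iff k hk
  · obtain ⟨j, hj⟩ := hh
    have h1 := hflag j h hj.symm
    have h2 := hall j
    tauto

/-- The curve has exactly two sides. -/
theorem reach_iff_not_reach (hG : G.IsConnected) (hC : M.dual.IsHamiltonianCycle x e)
    {f g : M.Flag} (hfg : ¬ Relation.ReflTransGen (M.GluedOff (Set.range e)) f g) (h : M.Flag) :
    Relation.ReflTransGen (M.GluedOff (Set.range e)) g h ↔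
      ¬ Relation.ReflTransGen (M.GluedOff (Set.range e)) f h := by
  have hp := isClosedOff_reach (C := Set.range e) f
  have hq := isClosedOff_reach (C := Set.range e) g
  have hgf : ¬ Relation.ReflTransGen (M.GluedOff (Set.range e)) g f := fun hgf =>
    hfg ((hp.iff_of_reach hgf).2 Relation.ReflTransGen.refl)
  have cp := fun k hk => hp.swapVertex_iff_not hG hC Relation.ReflTransGen.refl hfg (h := k) hk
  have cq := fun k hk => hq.swapVertex_iff_not hG hC Relation.ReflTransGen.refl hgf (h := k) hk
  have hdis : ∀ k, Relation.ReflTransGen (M.GluedOff (Set.range e)) g k →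
      ¬ Relation.ReflTransGen (M.GluedOff (Set.range e)) f k := fun k hk hk' =>
    hfg ((hp.iff_of_reach hk).2 hk')
  refine ⟨hdis h, fun hn => ?_⟩
  -- The union of the two sides is unchanged across the curve too, since each side flips there and
  -- they are disjoint; hence it is everything.
  have hor := IsClosedOff.forall_of_isConnected (M := M) hG
    (p := fun k => Relation.ReflTransGen (M.GluedOff (Set.range e)) f k ∨
      Relation.ReflTransGen (M.GluedOff (Set.range e)) g k)
    ⟨fun a => or_congr (hp.swapEdge_iff a) (hq.swapEdge_iff a),
      fun a => or_congr (hp.swapFace_iff a) (hq.swapFace_iff a), fun a _ => ?_⟩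
    (f := f) (Or.inl Relation.ReflTransGen.refl) h
  · exact hor.resolve_left hn
  · by_cases ha : M.edge a ∈ Set.range e
    · have h1 := hdis a
      have h2 := hdis (M.swapVertex a)
      have h3 := cp a ha
      have h4 := cq a ha
      tauto
    · exact or_congr (hp.swapVertex_iff a ha) (hq.swapVertex_iff a ha)

end Hamiltonian

end Graph.CellularEmbedding

/-! ### Spanning trees of the two sides and the final count -/

namespace RotationSystem

/-- The vertices that can be reached from `r` along edges in `T` are those of a tree. -/
theorem exists_isTreeFrom {E V : Type*} [DecidableEq E] [Finite E] (v : E × Bool → V) (r : V)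
    (T : Set E) : ∃ S : Finset E, (∀ e ∈ S, e ∈ T) ∧
      IsTreeFrom v r {y | Relation.ReflTransGen (fun x y => ∃ e ∈ T, Links v e x y) r y} S := by
  let P : Set (Finset E) := {S | (∀ e ∈ S, e ∈ T) ∧ ∃ U, IsTreeFrom v r U S}
  have hP : P.Nonempty := ⟨∅, by simp, {r}, IsTreeFrom.single⟩
  -- A maximal tree with edges in `T` contains every vertex reachable from `r`: an edge leaving it
  -- would enlarge it.
  obtain ⟨S, hS⟩ := P.toFinite.exists_maximal hP
  obtain ⟨hST, U, hU⟩ := hS.prop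
  refine ⟨S, hST, ?_⟩
  convert hU
  ext y
  constructor
  · intro hy
    induction hy with
    | refl => exact hU.root_mem
    | @tail x y _ hs ih =>
      obtain ⟨e, heT, he⟩ := hs
      by_contra hyU
      have hmem : insert e S ∈ P := by
        refine ⟨fun f hf => ?_, _, hU.grow ih hyU he⟩
        rcases Finset.mem_insert.1 hf with rfl | hf
        · exact heT
        · exact hST f hf
      exact hU.notMem he hyU
        (hS.le_of_ge hmem (Finset.subset_insert e S) (Finset.mem_insert_self e S))
  · clear hS hP
    intro hy
    induction hU generalizing y with
    | single => rw [Set.mem_singleton_iff.1 hy]; exact Relation.ReflTransGen.refl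
    | grow hU hx _ he ih =>
      have hST' := fun f hf => hST f (Finset.mem_insert_of_mem hf)
      rcases hy with rfl | hy
      · exact (ih hST' _ hx).tail ⟨_, hST _ (Finset.mem_insert_self _ _), he⟩
      · exact ih hST' y hy

end RotationSystem

namespace Graph

variable {α β : Type*} {G : Graph α β} {m : ℕ} {v : Fin m × Bool → α} (ι : Fin m ≃ G.edgeSet)

open RotationSystem

theorem links_iff_isLink (hv : ∀ i, G.IsLink (ι i) (v (i, false)) (v (i, true))) {i : Fin m}
    {x y : α} : Links v i x y ↔ G.IsLink (ι i) x y := by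
  constructor
  · rintro ⟨b, rfl, rfl⟩
    cases b
    · exact hv i
    · exact (hv i).symm
  · intro h
    rcases (hv i).eq_and_eq_or_eq_and_eq h with ⟨h1, h2⟩ | ⟨h1, h2⟩
    · exact ⟨false, h1, h2⟩
    · exact ⟨true, h2, h1⟩

namespace CellularEmbedding

variable {M : G.CellularEmbedding}

/-- Each side of the curve given by `C` contains a tree through all its vertices. -/
theorem exists_isTreeFrom (hv : ∀ i, G.IsLink (ι i) (v (i, false)) (v (i, true))) (C : Set β)
    (f : M.Flag) : ∃ S : Finset (Fin m), (∀ i ∈ S, (ι i : β) ∉ C) ∧ IsTreeFrom v (M.vertex f)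
      (M.vertex '' {h | Relation.ReflTransGen (M.GluedOff C) f h}) S := by
  obtain ⟨S, h1, h2⟩ := RotationSystem.exists_isTreeFrom v (M.vertex f) {i | (ι i : β) ∉ C}
  refine ⟨S, h1, ?_⟩
  convert h2
  have hp := isClosedOff_reach (M := M) (C := C) f
  ext y
  constructor
  · rintro ⟨h, hh, rfl⟩
    change Relation.ReflTransGen _ _ _ at hh
    induction hh with
    | refl => exact Relation.ReflTransGen.refl
    | @tail a b _ hs ih =>
      rcases hs with rfl | rfl | ⟨hC, rfl⟩
      · rwa [M.vertex_swapEdge]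
      · rwa [M.vertex_swapFace]
      · refine Relation.ReflTransGen.tail ih ⟨ι.symm ⟨M.edge a, (M.isLink a).edge_mem⟩, ?_, ?_⟩
        · simpa using hC
        · rw [links_iff_isLink ι hv]
          simpa using M.isLink a
  · intro hy
    change Relation.ReflTransGen _ _ _ at hy
    induction hy with
    | refl => exact ⟨f, Relation.ReflTransGen.refl, rfl⟩
    | tail _ hs ih =>
      obtain ⟨i, hi, hl⟩ := hs
      obtain ⟨h, hh, hhv⟩ := ih
      rw [links_iff_isLink ι hv] at hl
      obtain ⟨k, hk, hk1, hk2⟩ := exists_flag_of_isLink (M := M) hl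
      refine ⟨M.swapVertex k, ?_, hk2⟩
      exact (hp.swapVertex_iff k (by rwa [hk])).2
        ((hp.iff_of_vertex_eq (hhv.trans hk1.symm)).1 hh)

/-- Two faces for the two trees with the curve edges, and at most one more for each of the two
remaining edges. -/
theorem hasRotation_of_isSurfaceSeparating (hG : G.IsConnected)
    (hM : M.eulerChar = 0) {n : ℕ} {x : Fin (n + 1) → M.Face} {e : Fin (n + 1) → β}
    (hC : M.dual.IsHamiltonianCycle x e) (hsep : M.IsSurfaceSeparating (Set.range e))
    (hv : ∀ i, G.IsLink (ι i) (v (i, false)) (v (i, true))) :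
    HasRotation v Finset.univ G.vertexSet 4 := by
  classical
  obtain ⟨f₀, g, hf₀g⟩ := hsep
  set C := Set.range e with hCdef
  obtain ⟨k, hk⟩ : ∃ k, M.edge k = e 0 := by
    obtain ⟨k, hk, -⟩ := hC.isLink 0
    exact ⟨k, hk⟩
  have hp₀ := isClosedOff_reach (M := M) (C := C) f₀
  -- a flag at the edge `e 0` on the side of `f₀`
  obtain ⟨f, hfe, hf₀f⟩ : ∃ f, M.edge f = e 0 ∧ Relation.ReflTransGen (M.GluedOff C) f₀ f := by
    by_cases h : Relation.ReflTransGen (M.GluedOff C) f₀ k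
    · exact ⟨k, hk, h⟩
    · exact ⟨M.swapVertex k, by rw [M.edge_swapVertex, hk],
        (hp₀.swapVertex_iff_not hG hC Relation.ReflTransGen.refl hf₀g (by rw [hk]; exact ⟨0, rfl⟩)).2
          h⟩
  have hp := isClosedOff_reach (M := M) (C := C) f
  have hq := isClosedOff_reach (M := M) (C := C) g
  have hfg : ¬ Relation.ReflTransGen (M.GluedOff C) f g := fun h => hf₀g (hf₀f.trans h)
  have hiff := reach_iff_not_reach hG hC hfg
  have hcross : ∀ h, M.edge h ∈ C → (Relation.ReflTransGen (M.GluedOff C) f (M.swapVertex h) ↔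
      ¬ Relation.ReflTransGen (M.GluedOff C) f h) := fun h hh =>
    hp.swapVertex_iff_not hG hC Relation.ReflTransGen.refl hfg hh
  obtain ⟨SA, hSA, hA⟩ := exists_isTreeFrom ι hv C f
  obtain ⟨SB, hSB, hB⟩ := exists_isTreeFrom ι hv C g
  set A := M.vertex '' {h | Relation.ReflTransGen (M.GluedOff C) f h} with hAdef
  set B := M.vertex '' {h | Relation.ReflTransGen (M.GluedOff C) g h} with hBdef
  have hAB : Disjoint A B := by
    rw [Set.disjoint_left]
    rintro _ ⟨h, hh, rfl⟩ ⟨h', hh', hv'⟩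
    exact (hiff h').1 hh' ((hp.iff_of_vertex_eq hv').2 hh)
  have hUnion : A ∪ B = G.vertexSet := by
    ext y
    constructor
    · rintro (⟨h, -, rfl⟩ | ⟨h, -, rfl⟩)
      · exact (M.isLink h).left_mem
      · exact (M.isLink h).left_mem
    · intro hy
      obtain ⟨h, rfl⟩ := exists_vertex_eq hG f hy
      by_cases hh : Relation.ReflTransGen (M.GluedOff C) f h
      · exact Or.inl ⟨h, hh, rfl⟩
      · exact Or.inr ⟨h, (hiff h).2 hh, rfl⟩
  have hflag : ∀ i, ∃ h, M.edge h = ι i := fun i => M.exists_edge_eq _ (ι i).2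
  let CF : Finset (Fin m) := Finset.univ.filter fun i => (ι i : β) ∈ C
  have hlinkC : ∀ h, M.edge h ∈ C → Relation.ReflTransGen (M.GluedOff C) f h →
      M.vertex (M.swapVertex h) ∈ B := fun h hh hfh =>
    ⟨_, (hiff _).2 fun h1 => (hcross h hh).1 h1 hfh, rfl⟩
  have hrot := hA.hasRotation_union hB hAB (C := CF) ?_ ?_
  · rw [hUnion] at hrot
    have hQ := hrot.union (Q := Finset.univ \ (SA ∪ SB ∪ CF)) ?_ ?_
    · rw [Finset.union_sdiff_of_subset (Finset.subset_univ _)] at hQ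
      refine hQ.mono ?_
      have hdAB : Disjoint SA SB := by
        rw [Finset.disjoint_left]
        intro i hi hi'
        exact Set.disjoint_left.1 hAB (hA.image_subset ⟨(i, true), hi, rfl⟩)
          (hB.image_subset ⟨(i, true), hi', rfl⟩)
      have hdC : Disjoint (SA ∪ SB) CF := by
        rw [Finset.disjoint_left]
        intro i hi hi'
        have hi' : (ι i : β) ∈ C := (Finset.mem_filter.1 hi').2
        rcases Finset.mem_union.1 hi with hi | hi
        · exact hSA i hi hi'
        · exact hSB i hi hi'
      have c1 : (SA ∪ SB ∪ CF).card = SA.card + SB.card + CF.card := by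
        rw [Finset.card_union_of_disjoint hdC, Finset.card_union_of_disjoint hdAB]
      have c2 := Finset.card_sdiff_add_card_eq_card (Finset.subset_univ (SA ∪ SB ∪ CF))
      rw [Finset.card_univ, Fintype.card_fin, c1] at c2
      have c3 : CF.card = n + 1 := by
        have hmem : ∀ j, e j ∈ G.edgeSet := fun j => (hC.isLink j).edge_mem
        have : CF = Finset.univ.image fun j => ι.symm ⟨e j, hmem j⟩ := by
          ext i
          simp only [CF, hCdef, Finset.mem_filter, Finset.mem_univ, true_and, Finset.mem_image,
            Set.mem_range, Equiv.symm_apply_eq, Subtype.ext_iff]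
        rw [this, Finset.card_image_of_injective, Finset.card_univ, Fintype.card_fin]
        intro j j' hjj
        exact hC.edge_injective (congrArg Subtype.val (ι.symm.injective hjj))
      -- The cycle visits every face once, so it has as many edges as there are faces.
      have c4 : M.numFaces = n + 1 := by
        rw [numFaces, if_neg (not_isEmpty_iff.2 ⟨f⟩), ← Nat.card_fin (n + 1)]
        refine (Nat.card_eq_of_bijective x ⟨hC.vertex_injective, ?_⟩).symm
        rw [← Set.range_eq_univ, hC.range_vertex]
        rfl
      have c5 : G.edgeSet.ncard = m := by
        rw [← Nat.card_coe_set_eq, ← Nat.card_congr ι, Nat.card_fin]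
      have c6 : G.vertexSet.ncard = A.ncard + B.ncard := by
        rw [← hUnion, Set.ncard_union_eq hAB hA.finite hB.finite]
      have c7 := hA.ncard_eq
      have c8 := hB.ncard_eq
      -- m = |V| + |F| = (|SA| + 1) + (|SB| + 1) + |CF|, so two edges lie outside the union.
      rw [eulerChar, c4, c5, c6] at hM
      omega
    · intro i hi
      exact (Finset.mem_sdiff.1 hi).2
    · intro i _
      exact ⟨_, (hv i).left_mem, _, (hv i).right_mem, (links_iff_isLink ι hv).2 (hv i)⟩
  · intro i hi
    have hi : (ι i : β) ∈ C := (Finset.mem_filter.1 hi).2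
    obtain ⟨h, hh⟩ := hflag i
    obtain ⟨h', hh', hfh'⟩ : ∃ h', M.edge h' = ι i ∧
        Relation.ReflTransGen (M.GluedOff C) f h' := by
      by_cases hfh : Relation.ReflTransGen (M.GluedOff C) f h
      · exact ⟨h, hh, hfh⟩
      · exact ⟨M.swapVertex h, by rw [M.edge_swapVertex, hh],
          (hcross h (by rwa [hh])).2 hfh⟩
    refine ⟨_, ⟨h', hfh', rfl⟩, _, hlinkC h' (by rwa [hh']) hfh', ?_⟩
    rw [links_iff_isLink ι hv, ← hh']
    exact M.isLink h'
  -- This is why `f` was chosen on `e 0`: the root of the first tree must have a cross edge.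
  · have hfC : M.edge f ∈ C := by rw [hfe]; exact ⟨0, rfl⟩
    refine ⟨ι.symm ⟨M.edge f, (M.isLink f).edge_mem⟩, ?_, _,
      hlinkC f hfC Relation.ReflTransGen.refl, ?_⟩
    · simpa [CF] using hfC
    · rw [links_iff_isLink ι hv]
      simpa using M.isLink f

end CellularEmbedding

end Graph

theorem corollary2 {α β : Type*} (G : Graph α β)
    (hV : G.vertexSet.Finite) (hE : G.edgeSet.Finite) (hG : G.IsConnected)
    (M : Graph.CellularEmbedding G) (hM : M.IsKleinBottle)
    (n : ℕ) (x : Fin (n + 1) → M.Face) (e : Fin (n + 1) → β)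
    (hC : M.dual.IsHamiltonianCycle x e) (hsep : M.IsSurfaceSeparating (Set.range e)) :
    ⌊(G.bettiNumber : ℚ) / 2⌋ - 1 ≤ (G.maxGenus : ℤ) := by
  have := hE.to_subtype
  obtain ⟨m, ⟨ι'⟩⟩ := Finite.exists_equiv_fin G.edgeSet
  let ι : Fin m ≃ G.edgeSet := ι'.symm
  have hends : ∀ i, ∃ x y, G.IsLink (ι i) x y := fun i =>
    (G.edge_mem_iff_exists_isLink _).1 (ι i).2
  choose a b hab using hends
  let v : Fin m × Bool → α := fun d => if d.2 then b d.1 else a d.1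
  have hv : ∀ i, G.IsLink (ι i) (v (i, false)) (v (i, true)) := hab
  have hm : 0 < m := (ι.symm ⟨e 0, (hC.isLink 0).edge_mem⟩).pos
  have hχ : M.eulerChar = 0 := by
    rw [hM.2]
    rfl
  have hrot := Graph.CellularEmbedding.hasRotation_of_isSurfaceSeparating ι hG hχ hC hsep hv
  have hle := hrot.bettiNumber_le hm ι hv
  -- From β - 3 ≤ 2γ and 2⌊β/2⌋ ≤ β, integrality gives the bound.
  have hfl : (⌊(G.bettiNumber : ℚ) / 2⌋ : ℚ) ≤ (G.bettiNumber : ℚ) / 2 := Int.floor_le _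
  have h2 : 2 * ⌊(G.bettiNumber : ℚ) / 2⌋ ≤ G.bettiNumber := by
    have : (2 * ⌊(G.bettiNumber : ℚ) / 2⌋ : ℚ) ≤ G.bettiNumber := by linarith
    exact_mod_cast this
  push_cast at hle
  omega
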